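/- \textbf{Setting.} Let $\mathcal Y=\mathcal Y_1\times\cdots\times\mathcal Y_l$ be a product of finite sets, $\mathcal X$ a measurable space and $\mathcal Z=\mathcal X\times\mathcal Y$. Let $F$ be the finite set of factor nodes of a factor graph with variable nodes $1,\dots,l$. For $f\in F$ let $\mathcal N(f)$ be the set of variable nodes joined to $f$, let $\mathcal Y_f=\prod_{k\in\mathcal N(f)}\mathcal Y_k$, and for $y\in\mathcal Y$ let $y_f=(y^k)_{k\in\mathcal N(f)}$. Assume $|\mathcal Y_f|=d$ for all $f\in F$. Let $1<p\le 2$, $q=p/(p-1)$, $\Lambda\ge 0$, $\rho>0$, and write $\|v\|_r=(\sum_i|v_i|^r)^{1/r}$. Let $\Psi_f:\mathcal X\times\mathcal Y_f\to\mathbb R^D$ $(f\in F)$ be measurable feature maps with $$\Psi^*:=\sup_{f\in F,\,x\in\mathcal X,\,y\in\mathcal Y_f}\|\Psi_f(x,y)\|_q<\infty ,$$ put $\Psi(x,y)=\sum_{f\in F}\Psi_f(x,y_f)$ and $$\mathcal H_p=\{(x,y)\mapsto\langle w,\Psi(x,y)\rangle:\ w\in\mathbb R^D,\ \|w\|_p\le\Lambda\}.$$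 Let $L:\mathcal Y\times\mathcal Y\to[0,\infty)$, $M=\max_{y,y'}L(y,y')$, $\Phi^*(r)=\min(M,\max(0,r))$, and define the margin loss of $h:\mathcal X\times\mathcal Y\to\mathbb R$ at $z=(x,y)$ by $$L_\rho(z,h)=\Phi^*\Big(\max_{y'\ne y}\big\{L(y',y)-\tfrac1\rho[h(x,y)-h(x,y')]\big\}\Big)$$ (equal to $0$ if $y$ is the only label). Let $(\zeta^k)_{k\in\mathbb Z}$ be a stationary $\mathcal Z$-valued process with law $P$ which is $\beta$-mixing: $\beta(a)\to0$ as $a\to\infty$, where $$\beta(a)=\sup_{L\ge1}\mathbb E\Big[\sup_{B\in\sigma(\zeta^{L+a},\zeta^{L+a+1},\dots)}\big|P(B\mid\zeta^1,\dots,\zeta^L)-P(B)\big|\Big]$$ (the inner supremum being an essential supremum). Let $m,J,a\ge 1$ be integers with $2a\mid J$, and let the sample $S$ consist of $m$ i.i.d. documents $D_i=(z_i^1,\dots,z_i^J)$, each distributed as $(\zeta^1,\dots,\zeta^J)$. Put $$\hat R_S(h)=\frac1{mJ}\sum_{i=1}^m\sum_{j=1}^J L_\rho(z_i^j,h),\qquad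 R(h)=\mathbb E_S[\hat R_S(h)].$$ \textbf{Theorem.} There is an absolute constant $C>0$ such that in every such setting and for every $\delta>2m\big(\frac J{2a}-1\big)\beta(a)$, with probability at least $1-\delta$, simultaneously for all $h\in\mathcal H_p$, $$R(h)\le\hat R_S(h)+C\,\frac{\sqrt{2a(q-1)}\,\Psi^*\Lambda|F|}{\rho\sqrt{mJ}}\,\tilde L+\frac{M\sqrt a\,\sqrt{\log\Big(\frac{2}{\delta-2m(\frac J{2a}-1)\beta(a)}\Big)}}{\sqrt{mJ}},$$ where $\tilde L=\sqrt{\log\big(2mJd|F|\,[8\Psi^*\Lambda mJ/\rho+3]+1\big)}\,\log(mJ)$. (For $\delta\ge1$ the claim is void.) -/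

import Mathlib

open MeasureTheory ProbabilityTheory Filter Topology
open scoped ENNReal

namespace StructuredPrediction

/-- A factor graph with variable nodes `Fin l` and factor nodes `F`; the edges join a variable node
to a factor node. -/
structure FactorGraph (l : ℕ) (F : Type*) where
  edges : Set (Fin l × F)

/-- The set `𝒩(f)` of variable nodes joined to the factor `f`. -/
def FactorGraph.nbhd {l : ℕ} {F : Type*} (G : FactorGraph l F) (f : F) : Set (Fin l) :=
  {k | (k, f) ∈ G.edges}

/-- The label set `𝒴_f = ∏_{k ∈ 𝒩(f)} 𝒴_k` of the factor `f`. -/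
abbrev FactorGraph.FactorLabel {l : ℕ} {F : Type*} (G : FactorGraph l F) (Y : Fin l → Type*)
    (f : F) : Type _ :=
  ∀ k : G.nbhd f, Y k

/-- The part `y_f = (y^k)_{k ∈ 𝒩(f)}` of the label `y`. -/
def FactorGraph.proj {l : ℕ} {F : Type*} (G : FactorGraph l F) {Y : Fin l → Type*}
    (f : F) (y : ∀ k, Y k) : G.FactorLabel Y f :=
  fun k => y k

/-- The `ℓ_p`-norm `(∑ |v_i| ^ p) ^ (1 / p)` on `ℝ^D`. -/
noncomputable def pNorm {D : ℕ} (p : ℝ) (v : Fin D → ℝ) : ℝ :=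
  (∑ i, |v i| ^ p) ^ (1 / p)

/-- The joint feature map `Ψ(x, y) = ∑_f Ψ_f(x, y_f)`. -/
noncomputable def feature {l : ℕ} {F : Type*} [Fintype F] (G : FactorGraph l F)
    {X : Type*} {Y : Fin l → Type*} {D : ℕ}
    (Ψ : ∀ f : F, X → G.FactorLabel Y f → Fin D → ℝ) (x : X) (y : ∀ k, Y k) : Fin D → ℝ :=
  ∑ f, Ψ f x (G.proj f y)

/-- The class `ℋ_p` of linear scoring functions `(x, y) ↦ ⟨w, Ψ(x, y)⟩` with `‖w‖_p ≤ Λ`. -/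
def linearClass {l : ℕ} {F : Type*} [Fintype F] (G : FactorGraph l F)
    {X : Type*} {Y : Fin l → Type*} {D : ℕ}
    (Ψ : ∀ f : F, X → G.FactorLabel Y f → Fin D → ℝ) (p Λ : ℝ) : Set (X → (∀ k, Y k) → ℝ) :=
  {h | ∃ w : Fin D → ℝ, pNorm p w ≤ Λ ∧ ∀ x y, h x y = ∑ i, w i * feature G Ψ x y i}

/-- The set of all values `‖Ψ_f(x, y)‖_q`, for `f ∈ F`, `x ∈ 𝒳`, `y ∈ 𝒴_f`. -/
def featureNorms {l : ℕ} {F : Type*} (G : FactorGraph l F)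
    {X : Type*} {Y : Fin l → Type*} {D : ℕ}
    (Ψ : ∀ f : F, X → G.FactorLabel Y f → Fin D → ℝ) (q : ℝ) : Set ℝ :=
  {r | ∃ (f : F) (x : X) (y : G.FactorLabel Y f), r = pNorm q (Ψ f x y)}

/-- `Ψ^* = sup_{f, x, y} ‖Ψ_f(x, y)‖_q`. -/
noncomputable def featureBound {l : ℕ} {F : Type*} (G : FactorGraph l F)
    {X : Type*} {Y : Fin l → Type*} {D : ℕ}
    (Ψ : ∀ f : F, X → G.FactorLabel Y f → Fin D → ℝ) (q : ℝ) : ℝ :=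
  sSup (featureNorms G Ψ q)

/-- The largest value `M = max_{y, y'} L(y, y')` of a loss on a finite label set. -/
noncomputable def maxLoss {𝒴 : Type*} (L : 𝒴 → 𝒴 → ℝ) : ℝ :=
  ⨆ yy : 𝒴 × 𝒴, L yy.1 yy.2

/-- The margin loss `L_ρ(x, y, h) = Φ^*(max_{y' ≠ y} {L(y', y) - (h(x, y) - h(x, y')) / ρ})`, where
`Φ^*(r) = min(M, max(0, r))`.  If `y` is the only label, the maximum is over the empty set and the
loss is `0`. -/
noncomputable def marginLoss {X 𝒴 : Type*} (L : 𝒴 → 𝒴 → ℝ) (ρ : ℝ) (h : X → 𝒴 → ℝ)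
    (z : X × 𝒴) : ℝ :=
  min (maxLoss L)
    (max 0 (⨆ y' : {y' : 𝒴 // y' ≠ z.2}, (L y' z.2 - 1 / ρ * (h z.1 z.2 - h z.1 y'))))

/-- The empirical risk `(1 / (mJ)) ∑_i ∑_j L_ρ(z_i^j, h)` of `h` on `m` documents of length `J`. -/
noncomputable def empiricalRisk {X 𝒴 : Type*} {m J : ℕ} (L : 𝒴 → 𝒴 → ℝ) (ρ : ℝ)
    (S : Fin m → Fin J → X × 𝒴) (h : X → 𝒴 → ℝ) : ℝ :=
  1 / ((m : ℝ) * (J : ℝ)) * ∑ i, ∑ j, marginLoss L ρ h (S i j)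

/-- The true risk of `h`: the expectation of its empirical risk on the random sample `D`. -/
noncomputable def trueRisk {X 𝒴 Ω : Type*} {m J : ℕ} [MeasurableSpace Ω] (μ : Measure Ω)
    (L : 𝒴 → 𝒴 → ℝ) (ρ : ℝ) (D : Fin m → Ω → Fin J → X × 𝒴) (h : X → 𝒴 → ℝ) : ℝ :=
  ∫ ω, empiricalRisk L ρ (fun i => D i ω) h ∂μ

/-- A two-sided process is stationary: its law is invariant under every time shift. -/
def IsStationary {Ω Z : Type*} [MeasurableSpace Ω] [MeasurableSpace Z] (P : Measure Ω)
    (ζ : ℤ → Ω → Z) : Prop :=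
  ∀ k : ℤ, IdentDistrib (fun ω (n : ℤ) => ζ (n + k) ω) (fun ω (n : ℤ) => ζ n ω) P P

/-- `σ(ζ^1, …, ζ^L)`. -/
abbrev pastSigma {Ω Z : Type*} [MeasurableSpace Z] (ζ : ℤ → Ω → Z) (L : ℕ) : MeasurableSpace Ω :=
  ⨆ k ∈ Set.Icc (1 : ℤ) (L : ℤ), MeasurableSpace.comap (ζ k) inferInstance

/-- `σ(ζ^N, ζ^{N+1}, …)`. -/
abbrev futureSigma {Ω Z : Type*} [MeasurableSpace Z] (ζ : ℤ → Ω → Z) (N : ℕ) : MeasurableSpace Ω :=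
  ⨆ k ∈ Set.Ici (N : ℤ), MeasurableSpace.comap (ζ k) inferInstance

/-- `E[sup_{B ∈ 𝓑} |P(B | 𝓐) - P(B)|]`.  Each `P(B | 𝓐)` is determined only almost surely, so the
supremum of this possibly uncountable family is its essential supremum, the almost surely least
measurable function that dominates every member almost surely; its expectation is the infimum of
the expectations of all such dominating functions. -/
noncomputable def betaDependence {Ω : Type*} (𝓐 𝓑 : MeasurableSpace Ω) [mΩ : MeasurableSpace Ω]
    (P : Measure Ω) : ℝ≥0∞ :=
  ⨅ g ∈ {g : Ω → ℝ≥0∞ | Measurable[mΩ] g ∧ ∀ B : Set Ω, MeasurableSet[𝓑] B →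
      ∀ᵐ ω ∂P, ENNReal.ofReal |(P⟦B | 𝓐⟧) ω - P.real B| ≤ g ω},
    ∫⁻ ω, g ω ∂P

/-- The mixing coefficient
`β(a) = sup_{L ≥ 1} E[sup_{B ∈ σ(ζ^{L+a}, …)} |P(B | ζ^1, …, ζ^L) - P(B)|]` (it is at most `1`). -/
noncomputable def betaCoeff {Ω Z : Type*} [MeasurableSpace Ω] [MeasurableSpace Z] (P : Measure Ω)
    (ζ : ℤ → Ω → Z) (a : ℕ) : ℝ≥0∞ :=
  ⨆ L ∈ Set.Ici (1 : ℕ), betaDependence (pastSigma ζ L) (futureSigma ζ (L + a)) P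

/-- Stationary `β`-mixing processes. -/
structure IsBetaMixing {Ω Z : Type*} [MeasurableSpace Ω] [MeasurableSpace Z] (P : Measure Ω)
    (ζ : ℤ → Ω → Z) : Prop where
  measurable : ∀ k, Measurable (ζ k)
  stationary : IsStationary P ζ
  tendsto_zero : Tendsto (betaCoeff P ζ) atTop (𝓝 0)

/-- `L̃ = √(log(2 mJ d |F| [8 Ψ^* Λ mJ / ρ + 3] + 1)) · log(mJ)`, with `n = mJ`, `N = |F|`,
`B = Ψ^*`. -/
noncomputable def logFactor (n d N B Λ ρ : ℝ) : ℝ :=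
  Real.sqrt (Real.log (2 * n * d * N * (8 * B * Λ * n / ρ + 3) + 1)) * Real.log n

end StructuredPrediction

open StructuredPrediction

/-! ### Smoothness of the ℓ_q-norm and dimension-free covers of the ℓ_p-ball -/

namespace StructuredPrediction

/-! The uniform deviation is controlled for independent data and carried over to the mixing process
by blocking.

Blocking. Each document is cut into blocks of length `a`, and blocks of even and odd index are
treated separately. Within one parity, successive blocks are separated by a gap of length `a`, so
the law of the J/(2a) blocks of a document exceeds that of independent blocks by at most (J/(2a) -
1) β(a) on every event (`exceedsByAtMost_map_blocks`). Over m independent documents this costs m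
times as much. The sample average is the mean of the two parity averages, so a large deviation
forces one in some parity. The union bound over the two parities gives the term 2m(J/(2a) - 1) β(a).

Independent blocks. McDiarmid's inequality and symmetrization (`measure_exists_deviation_le`) leave
the empirical Rademacher average of the block-averaged losses. These losses depend on w only through
its inner products with the finitely many vectors Ψ_f(x, y) at the sampled inputs, and they are
2|F|/ρ-Lipschitz in the largest such inner product.

Complexity. It remains to cover the ℓ_p-ball in the supremum norm over finitely many vectors of the
ℓ_q-ball of radius Ψ^*. `exists_finset_cover` does this at radius ΛΨ^*/2^k with log-cardinality of
order (q - 1) 4^k log(number of vectors), whatever the dimension. The centres are the iterates of a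
mirror-descent algorithm that corrects its mistakes: the squared ℓ_q-norm is smooth with constant of
order q - 1, which bounds the number of mistakes, and an iterate is determined by its list of
mistakes. In the chaining sum (`signAvg_sup'_le_chaining`) every scale contributes the same amount,
so about log(mJ) scales produce the factor log(mJ) of L̃.

All this concerns finite sets of weights. The loss is continuous in w, so a countable dense subset
of the ball extends the bound to the whole class. -/

theorem one_add_rpow_add_one_sub_rpow_le {q t : ℝ} (hq : 2 ≤ q) (ht : 0 ≤ t) :
    ((1 + t) ^ q + |1 - t| ^ q) / 2 ≤ (1 + 4 * q * t ^ 2) ^ (q / 2) := by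
  have hq0 : 0 < q := by linarith
  have hsq : ∀ x : ℝ, 0 ≤ x → (x ^ 2) ^ (q / 2) = x ^ q := by
    intro x hx
    rw [← Real.rpow_natCast, ← Real.rpow_mul hx]
    congr 1; push_cast; ring
  -- For t > 0 the threshold is (1 + t)^2 ≤ 1 + 4qt^2, beyond which the larger term alone suffices.
  -- Below it 4qt^2 ≤ 1, and exponentials decide: the average is at most cosh(qt) ≤ exp(q^2t^2/2),
  -- while exp(2qt^2) ≤ 1 + 4qt^2.
  by_cases hlarge : 2 ≤ (4 * q - 1) * t
  · have h1 : |1 - t| ^ q ≤ (1 + t) ^ q :=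
      Real.rpow_le_rpow (abs_nonneg _) (abs_le.2 ⟨by linarith, by linarith⟩) hq0.le
    have h2 : (1 + t) ^ q ≤ (1 + 4 * q * t ^ 2) ^ (q / 2) := by
      rw [← hsq (1 + t) (by linarith)]
      refine Real.rpow_le_rpow (by positivity) ?_ (by linarith)
      nlinarith
    linarith
  · push Not at hlarge
    have ht1 : t < 1 := by nlinarith
    have hv : 4 * q * t ^ 2 ≤ 1 := by
      have h3 : ((4 * q - 1) * t) ^ 2 ≤ 2 ^ 2 := by
        apply pow_le_pow_left₀ _ hlarge.le
        apply mul_nonneg <;> linarith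
      nlinarith [sq_nonneg t, mul_nonneg (sq_nonneg t) (sq_nonneg (q - 2)), 
        mul_nonneg (sq_nonneg t) (sub_nonneg.2 hq)]
    have h1 : (1 + t) ^ q ≤ Real.exp (q * t) := by
      rw [mul_comm, Real.exp_mul]
      exact Real.rpow_le_rpow (by linarith) (by linarith [Real.add_one_le_exp t]) hq0.le
    have h2 : |1 - t| ^ q ≤ Real.exp (-(q * t)) := by
      rw [abs_of_pos (by linarith), show -(q * t) = -t * q by ring, Real.exp_mul]
      exact Real.rpow_le_rpow (by linarith) (by linarith [Real.add_one_le_exp (-t)]) hq0.le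
    have h3 : (Real.exp (q * t) + Real.exp (-(q * t))) / 2 ≤ Real.exp ((q * t) ^ 2 / 2) := by
      rw [← Real.cosh_eq]; exact Real.cosh_le_exp_half_sq _
    have h4 : Real.exp (2 * q * t ^ 2) ≤ 1 + 4 * q * t ^ 2 := by
      have hx0 : 0 ≤ 2 * q * t ^ 2 := by positivity
      have := Real.exp_bound' hx0 (by linarith) (n := 2) (by norm_num)
      simp [Finset.sum_range_succ] at this
      nlinarith
    have h5 : Real.exp ((q * t) ^ 2 / 2) ≤ (1 + 4 * q * t ^ 2) ^ (q / 2) := by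
      refine le_trans ?_ (Real.rpow_le_rpow (Real.exp_pos _).le h4 (by linarith))
      rw [← Real.exp_mul, Real.exp_le_exp]
      nlinarith [mul_nonneg (sq_nonneg q) (sq_nonneg t)]
    linarith

/-- Homogeneity reduces the case a ≠ 0 to the previous inequality with t = |b/a|. The bound 4q ≤ 8(q
- 1) for q ≥ 2 is what makes q - 1 appear in the final estimate. -/
theorem abs_add_rpow_add_abs_sub_rpow_le {q : ℝ} (hq : 2 ≤ q) (a b : ℝ) :
    (|a + b| ^ q + |a - b| ^ q) / 2 ≤ (a ^ 2 + 8 * (q - 1) * b ^ 2) ^ (q / 2) := by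
  have hq0 : 0 < q := by linarith
  have hsq : ∀ x : ℝ, (x ^ 2) ^ (q / 2) = |x| ^ q := by
    intro x
    rw [← sq_abs, ← Real.rpow_natCast, ← Real.rpow_mul (abs_nonneg x)]
    congr 1; push_cast; ring
  rcases eq_or_ne a 0 with rfl | ha
  · simp only [zero_add, zero_sub, abs_neg, add_self_div_two]
    rw [← hsq b]
    refine Real.rpow_le_rpow (sq_nonneg b) ?_ (by linarith)
    nlinarith [sq_nonneg b]
  · set t := |b / a| with ht
    have hkey := one_add_rpow_add_one_sub_rpow_le hq (abs_nonneg (b / a))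
    rw [← ht] at hkey
    have hb : |a| * t = |b| := by rw [ht, abs_div]; field_simp
    have hsum : |a + b| ^ q + |a - b| ^ q = (|a| * (1 + t)) ^ q + (|a| * |1 - t|) ^ q := by
      have e1 : |a| * (1 + t) = |a| + |b| := by rw [mul_add, hb, mul_one]
      have e2 : |a| * |1 - t| = abs (|a| - |b|) := by
        rw [← hb, ← abs_abs a, ← abs_mul, abs_abs]; congr 1; ring
      rw [e1, e2]
      rcases abs_cases a with ⟨h1, h1'⟩ | ⟨h1, h1'⟩ <;>
        rcases abs_cases b with ⟨h2, h2'⟩ | ⟨h2, h2'⟩ <;> rw [h1, h2]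
      · rw [abs_of_nonneg (by linarith : 0 ≤ a + b)]
      · rw [abs_of_nonneg (by linarith : 0 ≤ a - b)]
        rw [sub_neg_eq_add, ← sub_eq_add_neg, add_comm]
      · rw [show -a + b = -(a - b) by ring, show -a - b = -(a + b) by ring, abs_neg,
          abs_of_nonpos (by linarith : a - b ≤ 0), add_comm]
      · rw [show -a + -b = -(a + b) by ring, show -a - -b = -(a - b) by ring, abs_neg,
          abs_of_nonpos (by linarith : a + b ≤ 0)]
    have ht0 : 0 ≤ t := abs_nonneg _
    rw [hsum, Real.mul_rpow (abs_nonneg a) (by linarith),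
      Real.mul_rpow (abs_nonneg a) (abs_nonneg _), ← mul_add, mul_div_assoc]
    calc |a| ^ q * (((1 + t) ^ q + |1 - t| ^ q) / 2)
        ≤ (a ^ 2) ^ (q / 2) * (1 + 4 * q * t ^ 2) ^ (q / 2) := by
          rw [hsq]; exact mul_le_mul_of_nonneg_left hkey (by positivity)
      _ = (a ^ 2 * (1 + 4 * q * t ^ 2)) ^ (q / 2) := by
          rw [Real.mul_rpow (sq_nonneg a) (by positivity)]
      _ ≤ _ := by
          refine Real.rpow_le_rpow (by positivity) ?_ (by linarith)
          have : a ^ 2 * t ^ 2 = b ^ 2 := by rw [← sq_abs a, ← mul_pow, hb, sq_abs]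
          nlinarith [sq_nonneg b]

variable {D : ℕ}

theorem pNorm_nonneg (p : ℝ) (v : Fin D → ℝ) : 0 ≤ pNorm p v :=
  Real.rpow_nonneg (Finset.sum_nonneg fun _ _ => Real.rpow_nonneg (abs_nonneg _) _) _

theorem pNorm_rpow {p : ℝ} (hp : 0 < p) (v : Fin D → ℝ) : pNorm p v ^ p = ∑ i, |v i| ^ p := by
  rw [pNorm, ← Real.rpow_mul (Finset.sum_nonneg fun _ _ => Real.rpow_nonneg (abs_nonneg _) _),
    one_div_mul_cancel hp.ne', Real.rpow_one]

theorem pNorm_smul {p : ℝ} (hp : 0 < p) (c : ℝ) (v : Fin D → ℝ) :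
    pNorm p (c • v) = |c| * pNorm p v := by
  simp only [pNorm, Pi.smul_apply, smul_eq_mul, abs_mul,
    Real.mul_rpow (abs_nonneg _) (abs_nonneg _), ← Finset.mul_sum]
  rw [Real.mul_rpow (by positivity)
    (Finset.sum_nonneg fun _ _ => Real.rpow_nonneg (abs_nonneg _) _),
    ← Real.rpow_mul (abs_nonneg c), mul_one_div_cancel hp.ne', Real.rpow_one]

theorem pNorm_zero {p : ℝ} (hp : 0 < p) : pNorm p (0 : Fin D → ℝ) = 0 := by
  simpa using pNorm_smul hp 0 (0 : Fin D → ℝ)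

theorem sum_mul_le_pNorm_mul_pNorm {p q : ℝ} (hpq : p.HolderConjugate q) (u v : Fin D → ℝ) :
    ∑ i, u i * v i ≤ pNorm p u * pNorm q v :=
  Real.inner_le_Lp_mul_Lq Finset.univ u v hpq

theorem abs_sum_mul_le_pNorm_mul_pNorm {p q : ℝ} (hpq : p.HolderConjugate q) (u v : Fin D → ℝ) :
    |∑ i, u i * v i| ≤ pNorm p u * pNorm q v := by
  refine abs_le.2 ⟨?_, sum_mul_le_pNorm_mul_pNorm hpq u v⟩
  have h := sum_mul_le_pNorm_mul_pNorm hpq ((-1 : ℝ) • u) v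
  rw [pNorm_smul hpq.pos] at h
  simp at h
  linarith

/-- The `ℓ_q`-norm is attained by a functional of norm at most one. -/
theorem exists_dual_pNorm {p q : ℝ} (hpq : p.HolderConjugate q) (x : Fin D → ℝ) :
    ∃ v : Fin D → ℝ, ∑ i, v i * x i = pNorm q x ∧ ∀ z, ∑ i, v i * z i ≤ pNorm q z := by
  have hq : 0 < q := hpq.symm.pos
  rcases (pNorm_nonneg q x).eq_or_lt with h0 | hpos
  · exact ⟨0, by simp [← h0], fun z => by simpa using pNorm_nonneg q z⟩
  set N := pNorm q x with hN
  -- The equality case of Hölder: g pairs with x to N^q, and (q - 1)p = q gives g an ℓ_p-norm of at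
  -- most N^(q-1), by which it is then divided.
  set g : Fin D → ℝ := fun i => |x i| ^ (q - 1) * SignType.sign (x i) with hg
  have hsum : ∑ i, g i * x i = N ^ q := by
    rw [hN, pNorm_rpow hq]
    refine Finset.sum_congr rfl fun i _ => ?_
    rw [hg]; simp only
    rw [mul_assoc, sign_mul_self]
    rcases eq_or_ne (x i) 0 with h | h
    · simp [h, Real.zero_rpow hq.ne']
    · conv_rhs => rw [show q = q - 1 + 1 by ring, Real.rpow_add_one (abs_pos.2 h).ne']
  have hgN : pNorm p g ≤ N ^ (q - 1) := by
    have : ∑ i, |g i| ^ p ≤ N ^ q := by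
      rw [hN, pNorm_rpow hq]
      refine Finset.sum_le_sum fun i _ => ?_
      have h1 : |g i| ≤ |x i| ^ (q - 1) := by
        rw [hg]; simp only
        rw [abs_mul, abs_of_nonneg (Real.rpow_nonneg (abs_nonneg _) _)]
        refine mul_le_of_le_one_right (Real.rpow_nonneg (abs_nonneg _) _) ?_
        rcases lt_trichotomy (x i) 0 with h | h | h <;> simp [h]
      refine (Real.rpow_le_rpow (abs_nonneg _) h1 hpq.nonneg).trans_eq ?_
      rw [← Real.rpow_mul (abs_nonneg _), hpq.symm.sub_one_mul_conj]
    calc pNorm p g ≤ (N ^ q) ^ (1 / p) :=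
          Real.rpow_le_rpow (Finset.sum_nonneg fun _ _ => Real.rpow_nonneg (abs_nonneg _) _) this
            (by have := hpq.pos; positivity)
      _ = N ^ (q - 1) := by
          rw [← Real.rpow_mul hpos.le]
          congr 1
          have := hpq.symm.sub_one_mul_conj
          have hp := hpq.pos
          field_simp
          linarith
  have hNp : 0 < N ^ (q - 1) := Real.rpow_pos_of_pos hpos _
  refine ⟨(N ^ (q - 1))⁻¹ • g, ?_, fun z => ?_⟩
  · simp only [Pi.smul_apply, smul_eq_mul, mul_assoc, ← Finset.mul_sum]
    rw [hsum, inv_mul_eq_div, ← Real.rpow_sub hpos]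
    simp
  · simp only [Pi.smul_apply, smul_eq_mul, mul_assoc, ← Finset.mul_sum]
    rw [inv_mul_le_iff₀ hNp]
    exact (sum_mul_le_pNorm_mul_pNorm hpq g z).trans
      (mul_le_mul_of_nonneg_right hgN (pNorm_nonneg q z))

/-- Two-point form of the 2-uniform smoothness of `ℓ_q` for `q ≥ 2`. -/
theorem pNorm_add_sq_add_pNorm_sub_sq_le {q : ℝ} (hq : 2 ≤ q) (x y : Fin D → ℝ) :
    (pNorm q (x + y) ^ 2 + pNorm q (x - y) ^ 2) / 2
      ≤ pNorm q x ^ 2 + 8 * (q - 1) * pNorm q y ^ 2 := by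
  have hq0 : 0 < q := by linarith
  have hsq : ∀ a : ℝ, 0 ≤ a → (a ^ 2) ^ (q / 2) = a ^ q := by
    intro a ha
    rw [← Real.rpow_natCast, ← Real.rpow_mul ha]
    congr 1; push_cast; ring
  have hr : 1 ≤ q / 2 := by linarith
  have hr0 : 0 < q / 2 := by linarith
  have hA : 0 ≤ 8 * (q - 1) := by linarith
  set u := pNorm q (x + y)
  set v := pNorm q (x - y)
  have hu : 0 ≤ u := pNorm_nonneg _ _
  have hv : 0 ≤ v := pNorm_nonneg _ _
  -- Three ingredients: convexity of r^(q/2), the scalar inequality in each coordinate, and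
  -- Minkowski in ℓ_{q/2}, where the norm of the vector of squares is the squared ℓ_q-norm.
  have h1 : ((u ^ 2 + v ^ 2) / 2) ^ (q / 2) ≤ (u ^ q + v ^ q) / 2 := by
    have := (convexOn_rpow hr).2 (Set.mem_Ici.2 (sq_nonneg u)) (Set.mem_Ici.2 (sq_nonneg v))
      (by norm_num : (0 : ℝ) ≤ 1 / 2) (by norm_num : (0 : ℝ) ≤ 1 / 2) (by norm_num)
    simp only [smul_eq_mul] at this
    rw [hsq u hu, hsq v hv] at this
    rw [show (u ^ 2 + v ^ 2) / 2 = 1 / 2 * u ^ 2 + 1 / 2 * v ^ 2 by ring]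
    linarith
  have h2 : (u ^ q + v ^ q) / 2 ≤ ∑ i, (x i ^ 2 + 8 * (q - 1) * y i ^ 2) ^ (q / 2) := by
    rw [pNorm_rpow hq0, pNorm_rpow hq0, ← Finset.sum_add_distrib, Finset.sum_div]
    exact Finset.sum_le_sum fun i _ => abs_add_rpow_add_abs_sub_rpow_le hq (x i) (y i)
  have h3 := Real.Lp_add_le_of_nonneg (f := fun i => x i ^ 2)
    (g := fun i => 8 * (q - 1) * y i ^ 2) Finset.univ hr (fun i _ => sq_nonneg _)
    (fun i _ => mul_nonneg hA (sq_nonneg _))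
  have hpow : ∀ z : Fin D → ℝ, (∑ i, (z i ^ 2) ^ (q / 2)) ^ (1 / (q / 2)) = pNorm q z ^ 2 := by
    intro z
    have : ∀ i, (z i ^ 2) ^ (q / 2) = |z i| ^ q := fun i => by
      rw [← sq_abs, hsq _ (abs_nonneg _)]
    simp only [this]
    rw [pNorm, ← Real.rpow_natCast, ← Real.rpow_mul
      (Finset.sum_nonneg fun _ _ => Real.rpow_nonneg (abs_nonneg _) _)]
    congr 1; push_cast; field_simp
  have h4 : (∑ i, (8 * (q - 1) * y i ^ 2) ^ (q / 2)) ^ (1 / (q / 2))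
      = 8 * (q - 1) * pNorm q y ^ 2 := by
    simp only [Real.mul_rpow hA (sq_nonneg _), ← Finset.mul_sum]
    rw [Real.mul_rpow (Real.rpow_nonneg hA _)
      (Finset.sum_nonneg fun _ _ => Real.rpow_nonneg (sq_nonneg _) _), hpow,
      ← Real.rpow_mul hA, mul_one_div_cancel hr0.ne', Real.rpow_one]
  rw [hpow, h4] at h3
  refine le_trans ?_ h3
  have hb : 0 ≤ (u ^ 2 + v ^ 2) / 2 := by positivity
  calc (u ^ 2 + v ^ 2) / 2 = (((u ^ 2 + v ^ 2) / 2) ^ (q / 2)) ^ (1 / (q / 2)) := by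
        rw [← Real.rpow_mul hb, mul_one_div_cancel hr0.ne', Real.rpow_one]
    _ ≤ _ := Real.rpow_le_rpow (Real.rpow_nonneg hb _) (h1.trans h2) (by positivity)

/-- Smoothness of the squared `ℓ_q`-norm for `q ≥ 2`. -/
theorem exists_pNorm_add_sq_le {p q : ℝ} (hpq : p.HolderConjugate q) (hq : 2 ≤ q)
    (x : Fin D → ℝ) :
    ∃ v : Fin D → ℝ, ∀ y, pNorm q (x + y) ^ 2
      ≤ pNorm q x ^ 2 + 2 * ∑ i, v i * y i + 16 * (q - 1) * pNorm q y ^ 2 := by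
  obtain ⟨v, hvx, hv⟩ := exists_dual_pNorm hpq x
  refine ⟨pNorm q x • v, fun y => ?_⟩
  have h1 := pNorm_add_sq_add_pNorm_sub_sq_le hq x y
  have h2 := hv (x - y)
  simp only [Pi.sub_apply, mul_sub, Finset.sum_sub_distrib, hvx] at h2
  simp only [Pi.smul_apply, smul_eq_mul, mul_assoc, ← Finset.mul_sum]
  set s := ∑ i, v i * y i
  set N := pNorm q x
  have hN : 0 ≤ N := pNorm_nonneg _ _
  -- As v supports the norm at x, ‖x - y‖ ≥ N - s. Squaring settles s ≤ N, and for s ≥ N the left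
  -- side is nonpositive. Inserted in the two-point inequality, this removes the x - y term.
  have h3 : N ^ 2 - 2 * (N * s) ≤ pNorm q (x - y) ^ 2 := by
    rcases le_total s N with hs | hs
    · have := pow_le_pow_left₀ (sub_nonneg.2 hs) h2 2
      nlinarith [sq_nonneg s]
    · nlinarith [sq_nonneg (pNorm q (x - y))]
  linarith

/-- A mistake bound for mirror descent. A state (θ, v) consists of a dual vector and a gradient v of
half the squared norm at θ. If v misjudges w at some x_i by more than ε, then θ moves by ±η x_i.
Smoothness then makes 2⟨w, θ⟩ - ‖θ‖^2 provably larger by a fixed amount, so after t rounds either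
some v approximates w everywhere or this quantity has grown t times. The states depend on w only
through the list of mistakes, which is why they can be counted. -/
theorem exists_finset_cover_aux {ι : Type*} [Fintype ι] {p q : ℝ} (hpq : p.HolderConjugate q)
    (hq : 2 ≤ q) {Λ B ε : ℝ} (hB : 0 < B) (hε : 0 < ε) (x : ι → Fin D → ℝ)
    (hx : ∀ i, pNorm q (x i) ≤ B) (t : ℕ) :
    ∃ C : Finset ((Fin D → ℝ) × (Fin D → ℝ)), C.card ≤ (2 * Fintype.card ι + 1) ^ t ∧
      ∀ w : Fin D → ℝ, pNorm p w ≤ Λ →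
        (∃ c ∈ C, ∀ i, |∑ k, (w k - c.2 k) * x i k| ≤ ε) ∨
        ∃ c ∈ C, (∀ y, pNorm q (c.1 + y) ^ 2
            ≤ pNorm q c.1 ^ 2 + 2 * ∑ i, c.2 i * y i + 16 * (q - 1) * pNorm q y ^ 2) ∧
          pNorm q c.1 ^ 2 ≤ 2 * ∑ k, w k * c.1 k - t * (ε ^ 2 / (16 * (q - 1) * B ^ 2)) := by
  classical
  have hq0 : 0 < q := by linarith
  have hq1 : 0 < q - 1 := by linarith
  choose J hJ using fun θ : Fin D → ℝ => exists_pNorm_add_sq_le hpq hq θ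
  induction t with
  | zero =>
    refine ⟨{(0, J 0)}, by simp, fun w _ => Or.inr ⟨(0, J 0), by simp, hJ 0, ?_⟩⟩
    simp [pNorm_zero hq0]
  | succ t ih =>
    obtain ⟨C, hC, hcov⟩ := ih
    -- This η maximizes the guaranteed gain 2ηε - 16(q - 1)η^2B^2, with maximal value ηε.
    set η : ℝ := ε / (16 * (q - 1) * B ^ 2) with hη
    have hη0 : 0 < η := by positivity
    -- A round is either a mistake, with its index and sign, or `none` for a state that is kept:
    -- 2|ι| + 1 options.
    set step : ((Fin D → ℝ) × (Fin D → ℝ)) × (Option (ι × Bool)) →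
        (Fin D → ℝ) × (Fin D → ℝ) := fun r => match r.2 with
      | none => r.1
      | some (i, b) => (r.1.1 + (if b then η else -η) • x i,
          J (r.1.1 + (if b then η else -η) • x i)) with hstep
    refine ⟨(C ×ˢ Finset.univ).image step, ?_, fun w hw => ?_⟩
    · refine Finset.card_image_le.trans ?_
      rw [Finset.card_product, Finset.card_univ, Fintype.card_option, Fintype.card_prod,
        Fintype.card_bool, pow_succ, mul_comm (Fintype.card ι)]
      exact Nat.mul_le_mul_right _ hC
    · rcases hcov w hw with ⟨c, hc, hgood⟩ | ⟨c, hc, hsm, hpot⟩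
      · exact Or.inl ⟨c, Finset.mem_image.2 ⟨(c, none), by simp [hc], rfl⟩, hgood⟩
      · by_cases hgood : ∀ i, |∑ k, (w k - c.2 k) * x i k| ≤ ε
        · exact Or.inl ⟨c, Finset.mem_image.2 ⟨(c, none), by simp [hc], rfl⟩, hgood⟩
        · push Not at hgood
          obtain ⟨i, hi⟩ := hgood
          obtain ⟨b, hb⟩ : ∃ b : Bool,
              ε ≤ (if b then 1 else -1) * ∑ k, (w k - c.2 k) * x i k := by
            rcases abs_cases (∑ k, (w k - c.2 k) * x i k) with h | h
            · exact ⟨true, by simp; linarith⟩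
            · exact ⟨false, by simp; linarith⟩
          refine Or.inr ⟨step (c, some (i, b)), Finset.mem_image_of_mem _
            (Finset.mem_product.2 ⟨hc, Finset.mem_univ _⟩), hJ _, ?_⟩
          set s : ℝ := if b then 1 else -1 with hs
          have hsη : (if b then η else -η) = s * η := by rw [hs]; split_ifs <;> ring
          have hsabs : |s| = 1 := by rw [hs]; split_ifs <;> simp
          simp only [hstep, hsη]
          have h1 := hsm ((s * η) • x i)
          have h2 : pNorm q ((s * η) • x i) ≤ η * B := by
            rw [pNorm_smul hq0, abs_mul, hsabs, one_mul, abs_of_pos hη0]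
            exact mul_le_mul_of_nonneg_left (hx i) hη0.le
          have h3 : pNorm q ((s * η) • x i) ^ 2 ≤ (η * B) ^ 2 :=
            pow_le_pow_left₀ (pNorm_nonneg _ _) h2 2
          have h4 : 16 * (q - 1) * pNorm q ((s * η) • x i) ^ 2 ≤ 16 * (q - 1) * (η * B) ^ 2 :=
            mul_le_mul_of_nonneg_left h3 (by linarith)
          have h5 : 16 * (q - 1) * (η * B) ^ 2 = η * ε := by
            rw [hη]; field_simp
          have h6 : ε ^ 2 / (16 * (q - 1) * B ^ 2) = η * ε := by rw [hη]; ring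
          simp only [sub_mul, Finset.sum_sub_distrib] at hb
          have h7 := mul_le_mul_of_nonneg_left hb hη0.le
          have e1 : ∑ k, c.2 k * ((s * η) • x i) k = s * η * ∑ k, c.2 k * x i k := by
            rw [Finset.mul_sum]; refine Finset.sum_congr rfl fun k _ => ?_
            simp; ring
          have e2 : ∑ k, w k * (c.1 + (s * η) • x i) k
              = ∑ k, w k * c.1 k + s * η * ∑ k, w k * x i k := by
            rw [Finset.mul_sum, ← Finset.sum_add_distrib]
            refine Finset.sum_congr rfl fun k _ => ?_
            simp; ring
          rw [e1] at h1
          rw [e2, h6]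
          rw [h6] at hpot
          push_cast
          linarith

/-- A finite cover of the `ℓ_p`-ball in the supremum norm over finitely many points of an
`ℓ_q`-ball. -/
theorem exists_finset_cover {ι : Type*} [Fintype ι] {p q : ℝ} (hpq : p.HolderConjugate q)
    (hq : 2 ≤ q) {Λ B : ℝ} (hΛ : 0 ≤ Λ) (hB : 0 ≤ B) (x : ι → Fin D → ℝ)
    (hx : ∀ i, pNorm q (x i) ≤ B) (k : ℕ) :
    ∃ C : Finset (Fin D → ℝ),
      (C.card : ℝ) ≤ Real.exp (17 * (q - 1) * 4 ^ k * Real.log (2 * Fintype.card ι + 1)) ∧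
      ∀ w : Fin D → ℝ, pNorm p w ≤ Λ →
        ∃ c ∈ C, ∀ i, |∑ j, (w j - c j) * x i j| ≤ Λ * B / 2 ^ k := by
  classical
  have hq1 : 1 ≤ q - 1 := by linarith
  have hlog : 0 ≤ Real.log (2 * (Fintype.card ι : ℝ) + 1) := Real.log_nonneg (by simp)
  rcases (mul_nonneg hΛ hB).eq_or_lt with h0 | hpos
  · refine ⟨{0}, ?_, fun w hw => ⟨0, by simp, fun i => ?_⟩⟩
    · simpa using by positivity
    · simp only [Pi.zero_apply, sub_zero]
      refine (abs_sum_mul_le_pNorm_mul_pNorm hpq w (x i)).trans ?_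
      rw [← h0, zero_div]
      exact (mul_le_mul hw (hx i) (pNorm_nonneg _ _) hΛ).trans_eq h0.symm
  · have hB' : 0 < B := pos_of_mul_pos_right hpos hΛ
    have hΛ' : 0 < Λ := pos_of_mul_pos_left hpos hB
    set ε := Λ * B / 2 ^ k with hε
    have hε0 : 0 < ε := by positivity
    -- After this many mistakes 2⟨w, θ⟩ - ‖θ‖^2 would exceed Λ^2, against ⟨w, θ⟩ ≤ Λ‖θ‖. The added 1
    -- turns 16 into 17, since (q - 1) 4^k ≥ 1.
    set t := ⌊16 * (q - 1) * 4 ^ k⌋₊ + 1 with ht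
    obtain ⟨C, hC, hcov⟩ := exists_finset_cover_aux hpq hq (Λ := Λ) hB' hε0 x hx t
    refine ⟨C.image Prod.snd, ?_, fun w hw => ?_⟩
    · have h1 : ((C.image Prod.snd).card : ℝ) ≤ (2 * Fintype.card ι + 1 : ℝ) ^ t := by
        exact_mod_cast Finset.card_image_le.trans hC
      refine h1.trans ?_
      rw [← Real.exp_log (show (0 : ℝ) < (2 * Fintype.card ι + 1 : ℝ) ^ t by positivity),
        Real.exp_le_exp, Real.log_pow]
      refine mul_le_mul_of_nonneg_right ?_ hlog
      have h4 : (1 : ℝ) ≤ 4 ^ k := one_le_pow₀ (by norm_num)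
      have := Nat.floor_le (show 0 ≤ 16 * (q - 1) * 4 ^ k by positivity)
      rw [ht]; push_cast
      nlinarith
    · rcases hcov w hw with ⟨c, hc, hgood⟩ | ⟨c, hc, -, hpot⟩
      · exact ⟨c.2, Finset.mem_image_of_mem _ hc, hgood⟩
      · exfalso
        have h1 := sum_mul_le_pNorm_mul_pNorm hpq w c.1
        have h2 := mul_le_mul_of_nonneg_right hw (pNorm_nonneg q c.1)
        have h3 : ε ^ 2 / (16 * (q - 1) * B ^ 2) = Λ ^ 2 / (16 * (q - 1) * 4 ^ k) := by
          rw [hε, show (4 : ℝ) = 2 ^ 2 by norm_num, ← pow_mul, mul_comm 2 k, pow_mul]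
          field_simp
        have h4 : 16 * (q - 1) * 4 ^ k < (t : ℝ) := by
          rw [ht]; push_cast; exact Nat.lt_floor_add_one _
        have h5 : Λ ^ 2 < t * (Λ ^ 2 / (16 * (q - 1) * 4 ^ k)) := by
          have h4k : (0 : ℝ) < 16 * (q - 1) * 4 ^ k := by positivity
          rw [mul_div_assoc', lt_div_iff₀ h4k, mul_comm]
          exact mul_lt_mul_of_pos_right h4 (by positivity)
        rw [h3] at hpot
        nlinarith [sq_nonneg (Λ - pNorm q c.1)]

end StructuredPrediction

/-! ### Rademacher averages: Massart's lemma and chaining -/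

namespace StructuredPrediction

/-- The sign `±1` encoded by a Boolean. -/
def boolSign (b : Bool) : ℝ := if b then 1 else -1

theorem abs_boolSign (b : Bool) : |boolSign b| = 1 := by cases b <;> simp [boolSign]

theorem boolSign_not (b : Bool) : boolSign (!b) = -boolSign b := by cases b <;> simp [boolSign]

variable {ι : Type*} [Fintype ι] [DecidableEq ι]

/-- The average of a function over all sign patterns on `ι`. -/
noncomputable def signAvg (f : (ι → Bool) → ℝ) : ℝ :=
  (∑ ε, f ε) / 2 ^ Fintype.card ι

theorem signAvg_mono {f g : (ι → Bool) → ℝ} (h : ∀ ε, f ε ≤ g ε) : signAvg f ≤ signAvg g :=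
  div_le_div_of_nonneg_right (Finset.sum_le_sum fun ε _ => h ε) (by positivity)

theorem signAvg_const (c : ℝ) : signAvg (fun _ : ι → Bool => c) = c := by
  simp [signAvg]

theorem signAvg_add (f g : (ι → Bool) → ℝ) :
    signAvg (fun ε => f ε + g ε) = signAvg f + signAvg g := by
  simp [signAvg, Finset.sum_add_distrib, add_div]

theorem signAvg_const_mul (c : ℝ) (f : (ι → Bool) → ℝ) :
    signAvg (fun ε => c * f ε) = c * signAvg f := by
  simp [signAvg, ← Finset.mul_sum, mul_div_assoc]

theorem signAvg_sum {κ : Type*} (s : Finset κ) (f : κ → (ι → Bool) → ℝ) :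
    signAvg (fun ε => ∑ k ∈ s, f k ε) = ∑ k ∈ s, signAvg (f k) := by
  simp only [signAvg]
  rw [Finset.sum_comm, Finset.sum_div]

theorem signAvg_not (f : (ι → Bool) → ℝ) : signAvg (fun ε => f fun i => !ε i) = signAvg f := by
  unfold signAvg
  congr 1
  exact Equiv.sum_comp (Equiv.piCongrRight fun _ : ι => Equiv.boolNot) f

theorem signAvg_sum_boolSign_mul (a : ι → ℝ) :
    signAvg (fun ε => ∑ i, boolSign (ε i) * a i) = 0 := by
  have h := signAvg_not fun ε : ι → Bool => ∑ i, boolSign (ε i) * a i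
  have h2 : (fun ε : ι → Bool => ∑ i, boolSign (!ε i) * a i)
      = fun ε => (-1) * ∑ i, boolSign (ε i) * a i := by
    funext ε
    rw [Finset.mul_sum]
    exact Finset.sum_congr rfl fun i _ => by rw [boolSign_not]; ring
  rw [h2, signAvg_const_mul] at h
  linarith

/-- Jensen's inequality, by averaging the tangent line of exp at the mean. -/
theorem exp_signAvg_le (f : (ι → Bool) → ℝ) :
    Real.exp (signAvg f) ≤ signAvg fun ε => Real.exp (f ε) := by
  set A := signAvg f
  have h : ∀ ε, Real.exp A * (f ε + (1 - A)) ≤ Real.exp (f ε) := by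
    intro ε
    have := Real.add_one_le_exp (f ε - A)
    calc Real.exp A * (f ε + (1 - A)) ≤ Real.exp A * Real.exp (f ε - A) :=
          mul_le_mul_of_nonneg_left (by linarith) (Real.exp_pos _).le
      _ = Real.exp (f ε) := by rw [← Real.exp_add]; ring_nf
  have := signAvg_mono h
  rw [signAvg_const_mul, signAvg_add, signAvg_const] at this
  linarith

/-- The signs are independent, so the average factors into ∏ cosh(a_i). -/
theorem signAvg_exp_le (a : ι → ℝ) :
    signAvg (fun ε => Real.exp (∑ i, boolSign (ε i) * a i)) ≤ Real.exp ((∑ i, a i ^ 2) / 2) := by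
  have h : ∑ ε : ι → Bool, Real.exp (∑ i, boolSign (ε i) * a i)
      = ∏ i, ∑ b : Bool, Real.exp (boolSign b * a i) := by
    rw [Finset.prod_univ_sum, Fintype.piFinset_univ]
    exact Finset.sum_congr rfl fun ε _ => Real.exp_sum _ _
  have h2 : signAvg (fun ε => Real.exp (∑ i, boolSign (ε i) * a i)) = ∏ i, Real.cosh (a i) := by
    rw [signAvg, h, ← Finset.card_univ, ← Finset.prod_const, ← Finset.prod_div_distrib]
    refine Finset.prod_congr rfl fun i _ => ?_
    rw [Real.cosh_eq, Fintype.sum_bool]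
    simp [boolSign]
  rw [h2, Finset.sum_div, Real.exp_sum]
  exact Finset.prod_le_prod (fun i _ => (Real.cosh_pos _).le) fun i _ =>
    Real.cosh_le_exp_half_sq _

/-- **Massart's lemma**. -/
theorem signAvg_sup'_le {γ : Type*} (W : Finset γ) (hW : W.Nonempty) (v : γ → ι → ℝ) {r A : ℝ}
    (hr : 0 ≤ r) (hA : 0 < A) (hv : ∀ w ∈ W, ∑ i, v w i ^ 2 ≤ r ^ 2) (V : Finset (ι → ℝ))
    (hV : ∀ w ∈ W, v w ∈ V) (hcard : (V.card : ℝ) ≤ Real.exp A) :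
    signAvg (fun ε => W.sup' hW fun w => ∑ i, boolSign (ε i) * v w i) ≤ r * √(2 * A) := by
  classical
  set E := signAvg (fun ε => W.sup' hW fun w => ∑ i, boolSign (ε i) * v w i) with hE
  -- The exponential of a maximum is at most the sum over the distinct vectors `v w`. Only these are
  -- counted, so `V` and not the size of `W` enters.
  have hkey : ∀ s : ℝ, 0 < s → s * E ≤ A + s ^ 2 * r ^ 2 / 2 := by
    intro s hs
    set V' := W.image v
    have hV' : (V'.card : ℝ) ≤ Real.exp A := by
      refine le_trans ?_ hcard
      exact_mod_cast Finset.card_le_card (Finset.image_subset_iff.2 hV)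
    have h1 : Real.exp (s * E) ≤ Real.exp A * Real.exp (s ^ 2 * r ^ 2 / 2) := by
      calc Real.exp (s * E)
          ≤ signAvg fun ε => Real.exp
              (s * W.sup' hW fun w => ∑ i, boolSign (ε i) * v w i) := by
            rw [hE, ← signAvg_const_mul]; exact exp_signAvg_le _
        _ ≤ signAvg fun ε => ∑ u ∈ V', Real.exp (∑ i, boolSign (ε i) * (s * u i)) := by
            refine signAvg_mono fun ε => ?_
            obtain ⟨w, hw, hmax⟩ := Finset.exists_mem_eq_sup' hW
              fun w => ∑ i, boolSign (ε i) * v w i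
            rw [hmax]
            have : s * ∑ i, boolSign (ε i) * v w i = ∑ i, boolSign (ε i) * (s * v w i) := by
              rw [Finset.mul_sum]; exact Finset.sum_congr rfl fun i _ => by ring
            rw [this]
            exact Finset.single_le_sum
              (f := fun u : ι → ℝ => Real.exp (∑ i, boolSign (ε i) * (s * u i)))
              (fun u _ => (Real.exp_pos _).le) (Finset.mem_image_of_mem v hw)
        _ = ∑ u ∈ V', signAvg fun ε => Real.exp (∑ i, boolSign (ε i) * (s * u i)) :=
            signAvg_sum _ _
        _ ≤ ∑ u ∈ V', Real.exp (s ^ 2 * r ^ 2 / 2) := by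
            refine Finset.sum_le_sum fun u hu => (signAvg_exp_le _).trans ?_
            obtain ⟨w, hw, rfl⟩ := Finset.mem_image.1 hu
            rw [Real.exp_le_exp]
            simp only [mul_pow, ← Finset.mul_sum]
            have := mul_le_mul_of_nonneg_left (hv w hw) (sq_nonneg s)
            linarith
        _ ≤ Real.exp A * Real.exp (s ^ 2 * r ^ 2 / 2) := by
            rw [Finset.sum_const, nsmul_eq_mul]
            exact mul_le_mul_of_nonneg_right hV' (Real.exp_pos _).le
    rwa [← Real.exp_add, Real.exp_le_exp] at h1
  -- The choice s = √(2A)/r balances the two terms of `hkey`. For r = 0 a positive E is refuted by s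
  -- = 2A/E.
  rcases hr.eq_or_lt with rfl | hr
  · rw [zero_mul]
    by_contra! hpos
    have := hkey (2 * A / E) (by positivity)
    rw [div_mul_cancel₀ _ hpos.ne'] at this
    norm_num at this
    linarith
  · have hs : 0 < √(2 * A) := Real.sqrt_pos.2 (by linarith)
    have h1 := hkey (√(2 * A) / r) (by positivity)
    have h2 : (√(2 * A) / r) ^ 2 * r ^ 2 / 2 = A := by
      rw [div_pow, Real.sq_sqrt (by linarith)]; field_simp
    rw [h2, div_mul_eq_mul_div, div_le_iff₀ hr] at h1
    have h3 : √(2 * A) * √(2 * A) = 2 * A := Real.mul_self_sqrt (by linarith)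
    refine le_of_mul_le_mul_left ?_ hs
    nlinarith

/-- A discrete chaining bound for the sign average of a function of a linear map that is Lipschitz
in the supremum norm on finitely many points. -/
theorem signAvg_sup'_le_chaining {κ : Type*} [Fintype κ] {D : ℕ} {p q : ℝ}
    (hpq : p.HolderConjugate q) (hq : 2 ≤ q) {Λ B s A : ℝ} (hΛ : 0 ≤ Λ) (hB : 0 ≤ B) (hs : 0 ≤ s)
    (x : κ → Fin D → ℝ) (hx : ∀ k, pNorm q (x k) ≤ B)
    (hA : 0 < A) (hκ : Real.log (2 * Fintype.card κ + 1) ≤ A)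
    (φ : (Fin D → ℝ) → ι → ℝ)
    (hφ : ∀ u v η, (∀ k, |∑ j, (u j - v j) * x k j| ≤ η) → 0 ≤ η → ∀ i, |φ u i - φ v i| ≤ s * η)
    (W : Finset (Fin D → ℝ)) (hW : W.Nonempty) (hWΛ : ∀ w ∈ W, pNorm p w ≤ Λ) (K : ℕ) :
    signAvg (fun ε => W.sup' hW fun w => ∑ i, boolSign (ε i) * φ w i)
      ≤ K * (25 * (s * (Λ * B)) * √(Fintype.card ι) * √((q - 1) * A))
        + Fintype.card ι * (s * (Λ * B)) / 2 ^ K := by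
  classical
  have hq1 : 1 ≤ q - 1 := by linarith
  have hΛB : 0 ≤ Λ * B := mul_nonneg hΛ hB
  -- The cover at scale 0 is {0}, so all chains start at one point and the starting term has sign
  -- average zero. Centres may lie outside the ball, because `hφ` applies to all pairs of weights.
  have hcov : ∀ k : ℕ, ∃ (C : Finset (Fin D → ℝ)) (c : (Fin D → ℝ) → (Fin D → ℝ)),
      (k = 0 → ∀ w, c w = 0) ∧ (C.card : ℝ) ≤ Real.exp (17 * (q - 1) * 4 ^ k * A) ∧
      (∀ w ∈ W, c w ∈ C) ∧
      ∀ w ∈ W, ∀ i, |∑ j, (w j - c w j) * x i j| ≤ Λ * B / 2 ^ k := by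
    intro k
    rcases Nat.eq_zero_or_pos k with rfl | hk
    · refine ⟨{0}, fun _ => 0, fun _ _ => rfl, ?_, by simp, fun w hw i => ?_⟩
      · simpa using by positivity
      · simpa using (abs_sum_mul_le_pNorm_mul_pNorm hpq w (x i)).trans
          (mul_le_mul (hWΛ w hw) (hx i) (pNorm_nonneg _ _) hΛ)
    · obtain ⟨C, hC, hcov⟩ := exists_finset_cover hpq hq hΛ hB x hx k
      refine ⟨C, fun w => if h : pNorm p w ≤ Λ then (hcov w h).choose else 0,
        fun h => absurd h hk.ne', hC.trans ?_, fun w hw => ?_, fun w hw => ?_⟩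
      · rw [Real.exp_le_exp]
        exact mul_le_mul_of_nonneg_left hκ (by positivity)
      · simp only [dif_pos (hWΛ w hw)]
        exact (hcov w (hWΛ w hw)).choose_spec.1
      · simp only [dif_pos (hWΛ w hw)]
        exact (hcov w (hWΛ w hw)).choose_spec.2
  choose C c hc0 hCcard hcC hc using hcov
  have hdiff : ∀ w ∈ W, ∀ k i, |φ (c (k + 1) w) i - φ (c k w) i|
      ≤ 3 * (s * (Λ * B)) / 2 ^ (k + 1) := by
    intro w hw k i
    have := hφ (c (k + 1) w) (c k w) (Λ * B / 2 ^ (k + 1) + Λ * B / 2 ^ k) (fun j => ?_)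
      (by positivity) i
    · refine this.trans_eq ?_
      rw [pow_succ]; field_simp; ring
    · have e : ∑ l, (c (k + 1) w l - c k w l) * x j l
          = ∑ l, (w l - c k w l) * x j l - ∑ l, (w l - c (k + 1) w l) * x j l := by
        rw [← Finset.sum_sub_distrib]; exact Finset.sum_congr rfl fun l _ => by ring
      rw [e]
      refine (abs_sub _ _).trans ?_
      rw [add_comm]
      exact add_le_add (hc (k + 1) w hw j) (hc k w hw j)
  -- A link has length of order 2^(-k) and the number of links has logarithm of order 4^k, so the
  -- powers cancel in Massart's bound and no scale dominates. The constant is 3√68 ≤ 25, with 68 = 4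
  -- · 17 and 3 from 2^(-k-1) + 2^(-k).
  have hscale : ∀ k : ℕ, signAvg (fun ε => W.sup' hW fun w =>
      ∑ i, boolSign (ε i) * (φ (c (k + 1) w) i - φ (c k w) i))
        ≤ 25 * (s * (Λ * B)) * √(Fintype.card ι) * √((q - 1) * A) := by
    intro k
    set r : ℝ := √(Fintype.card ι) * (3 * (s * (Λ * B)) / 2 ^ (k + 1)) with hr
    have hA' : 0 < 2 * (17 * (q - 1) * 4 ^ (k + 1) * A) := by positivity
    refine (signAvg_sup'_le W hW (fun w i => φ (c (k + 1) w) i - φ (c k w) i) (r := r)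
      (by positivity) hA' (fun w hw => ?_)
      ((C (k + 1) ×ˢ C k).image fun u => fun i => φ u.1 i - φ u.2 i)
      (fun w hw => Finset.mem_image.2 ⟨(c (k + 1) w, c k w),
        Finset.mem_product.2 ⟨hcC _ w hw, hcC _ w hw⟩, rfl⟩) ?_).trans ?_
    · rw [hr, mul_pow, Real.sq_sqrt (Nat.cast_nonneg _), ← nsmul_eq_mul, ← Finset.card_univ]
      refine Finset.sum_le_card_nsmul _ _ _ fun i _ => ?_
      rw [← sq_abs]
      exact pow_le_pow_left₀ (abs_nonneg _) (hdiff w hw k i) 2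
    · have h1 : (((C (k + 1) ×ˢ C k).image fun u => fun i => φ u.1 i - φ u.2 i).card : ℝ)
          ≤ (C (k + 1)).card * (C k).card := by
        exact_mod_cast Finset.card_image_le.trans (Finset.card_product _ _).le
      refine h1.trans ((mul_le_mul (hCcard _) (hCcard _) (Nat.cast_nonneg _)
        (Real.exp_pos _).le).trans ?_)
      rw [← Real.exp_add, Real.exp_le_exp, two_mul]
      have : (4 : ℝ) ^ k ≤ 4 ^ (k + 1) := pow_le_pow_right₀ (by norm_num) (Nat.le_succ k)
      gcongr
    · have e1 : √(2 * (2 * (17 * (q - 1) * 4 ^ (k + 1) * A)))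
          = √68 * 2 ^ (k + 1) * √((q - 1) * A) := by
        rw [show 2 * (2 * (17 * (q - 1) * 4 ^ (k + 1) * A))
          = 68 * (4 ^ (k + 1) * ((q - 1) * A)) by ring, Real.sqrt_mul (by norm_num),
          Real.sqrt_mul (by positivity), show (4 : ℝ) = 2 ^ 2 by norm_num, ← pow_mul,
          mul_comm 2 (k + 1), pow_mul, Real.sqrt_sq (by positivity), mul_assoc]
      have e2 : 3 * √68 ≤ 25 := by
        have : √68 ≤ 25 / 3 := Real.sqrt_le_iff.2 ⟨by norm_num, by norm_num⟩
        linarith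
      rw [e1, hr]
      calc √(Fintype.card ι) * (3 * (s * (Λ * B)) / 2 ^ (k + 1))
            * (√68 * 2 ^ (k + 1) * √((q - 1) * A))
          = 3 * √68 * ((s * (Λ * B)) * √(Fintype.card ι) * √((q - 1) * A)) := by
            field_simp
        _ ≤ 25 * ((s * (Λ * B)) * √(Fintype.card ι) * √((q - 1) * A)) :=
            mul_le_mul_of_nonneg_right e2 (by positivity)
        _ = _ := by ring
  have hpoint : ∀ ε : ι → Bool, (W.sup' hW fun w => ∑ i, boolSign (ε i) * φ w i)
      ≤ (∑ i, boolSign (ε i) * φ 0 i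
        + ∑ k ∈ Finset.range K, W.sup' hW fun w =>
          ∑ i, boolSign (ε i) * (φ (c (k + 1) w) i - φ (c k w) i))
        + Fintype.card ι * (s * (Λ * B)) / 2 ^ K := by
    intro ε
    refine Finset.sup'_le _ _ fun w hw => ?_
    have h1 : ∑ k ∈ Finset.range K, ∑ i, boolSign (ε i) * (φ (c (k + 1) w) i - φ (c k w) i)
        ≤ ∑ k ∈ Finset.range K, W.sup' hW fun w =>
          ∑ i, boolSign (ε i) * (φ (c (k + 1) w) i - φ (c k w) i) :=
      Finset.sum_le_sum fun k _ => Finset.le_sup'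
        (fun w => ∑ i, boolSign (ε i) * (φ (c (k + 1) w) i - φ (c k w) i)) hw
    have h2 : ∑ k ∈ Finset.range K, ∑ i, boolSign (ε i) * (φ (c (k + 1) w) i - φ (c k w) i)
        = ∑ i, boolSign (ε i) * (φ (c K w) i - φ 0 i) := by
      rw [Finset.sum_comm]
      refine Finset.sum_congr rfl fun i _ => ?_
      rw [← Finset.mul_sum, Finset.sum_range_sub (fun k => φ (c k w) i), hc0 0 rfl w]
    have h3 : ∑ i, boolSign (ε i) * (φ w i - φ (c K w) i)
        ≤ Fintype.card ι * (s * (Λ * B)) / 2 ^ K := by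
      rw [mul_div_assoc, ← nsmul_eq_mul, ← Finset.card_univ]
      refine Finset.sum_le_card_nsmul _ _ _ fun i _ => ?_
      refine (le_abs_self _).trans ?_
      rw [abs_mul, abs_boolSign, one_mul, mul_div_assoc]
      exact hφ w (c K w) _ (fun j => hc K w hw j) (by positivity) i
    have h4 : ∑ i, boolSign (ε i) * φ w i = ∑ i, boolSign (ε i) * φ 0 i
        + ∑ i, boolSign (ε i) * (φ (c K w) i - φ 0 i)
        + ∑ i, boolSign (ε i) * (φ w i - φ (c K w) i) := by
      rw [← Finset.sum_add_distrib, ← Finset.sum_add_distrib]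
      exact Finset.sum_congr rfl fun i _ => by ring
    linarith
  refine (signAvg_mono hpoint).trans ?_
  rw [signAvg_add, signAvg_const, signAvg_add, signAvg_sum_boolSign_mul, zero_add, signAvg_sum]
  gcongr
  refine (Finset.sum_le_card_nsmul _ _ _ fun k _ => hscale k).trans_eq ?_
  rw [Finset.card_range, nsmul_eq_mul]

end StructuredPrediction

/-! ### Bounded differences, symmetrization and uniform deviations of independent variables -/

namespace StructuredPrediction

theorem integrable_of_measurable_of_abs_le {α : Type*} [MeasurableSpace α] {μ : Measure α}
    [IsFiniteMeasure μ] {f : α → ℝ} (hf : Measurable f) {K : ℝ} (hK : ∀ x, |f x| ≤ K) :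
    Integrable f μ :=
  Integrable.of_bound hf.aestronglyMeasurable K 
    (Eventually.of_forall fun x => (Real.norm_eq_abs (f x)).trans_le (hK x))

theorem abs_integral_le_of_abs_le {α : Type*} [MeasurableSpace α] {μ : Measure α}
    [IsProbabilityMeasure μ] {f : α → ℝ} {K : ℝ} (hK : ∀ x, |f x| ≤ K) :
    |∫ x, f x ∂μ| ≤ K := by
  have := norm_integral_le_of_norm_le_const (μ := μ)
    (Eventually.of_forall fun x => (Real.norm_eq_abs (f x)).trans_le (hK x))
  simpa using this

theorem measurePreserving_cons {E : Type*} [MeasurableSpace E] {n : ℕ}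
    (μ : Fin (n + 1) → Measure E) [∀ i, SigmaFinite (μ i)] :
    MeasurePreserving (fun r : E × (Fin n → E) => (Fin.cons r.1 r.2 : Fin (n + 1) → E))
      ((μ 0).prod (Measure.pi fun j => μ j.succ)) (Measure.pi μ) := by
  have h := (measurePreserving_piFinSuccAbove μ 0).symm
  simp only [Fin.zero_succAbove] at h
  convert h using 1
  funext r
  simp [MeasurableEquiv.piFinSuccAbove]
  rfl

/-- The map that flattens a doubly indexed family of points. -/
theorem measurePreserving_flatten {E ι κ τ : Type*} [MeasurableSpace E] [Fintype ι] [Fintype κ]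
    [Fintype τ] (e : τ ≃ ι × κ) (Q : Measure E) [IsProbabilityMeasure Q] :
    MeasurePreserving (fun (S : ι → κ → E) (t : τ) => S (e t).1 (e t).2)
      (Measure.pi fun _ : ι => Measure.pi fun _ : κ => Q) (Measure.pi fun _ : τ => Q) := by
  have hm : Measurable (fun (S : ι → κ → E) (t : τ) => S (e t).1 (e t).2) := by fun_prop
  refine ⟨hm, (Measure.pi_eq fun s hs => ?_).symm⟩
  rw [Measure.map_apply hm (MeasurableSet.univ_pi hs)]
  have : (fun (S : ι → κ → E) (t : τ) => S (e t).1 (e t).2) ⁻¹' (Set.univ.pi s)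
      = Set.univ.pi fun i => Set.univ.pi fun k => s (e.symm (i, k)) := by
    ext S
    simp only [Set.mem_preimage, Set.mem_pi, Set.mem_univ, true_imp_iff]
    exact ⟨fun h i k => by simpa using h (e.symm (i, k)), fun h t => by
      simpa using h (e t).1 (e t).2⟩
  rw [this, Measure.pi_pi]
  simp only [Measure.pi_pi]
  rw [← Fintype.prod_prod_type' fun i k => Q (s (e.symm (i, k)))]
  exact Fintype.prod_equiv e.symm _ _ fun x => rfl

/-- Hoeffding's lemma: oscillation at most c puts the values of f in the interval of length c that
starts at its infimum. -/
theorem integral_exp_le_of_abs_sub_le {E : Type*} [MeasurableSpace E] {Q : Measure E}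
    [IsProbabilityMeasure Q] {f : E → ℝ} (hf : Measurable f) {K c : ℝ} (hK : ∀ x, |f x| ≤ K)
    (hc0 : 0 ≤ c) (hc : ∀ x y, f x - f y ≤ c) (s : ℝ) :
    ∫ x, Real.exp (s * f x) ∂Q ≤ Real.exp (s * ∫ x, f x ∂Q + s ^ 2 * c ^ 2 / 8) := by
  have : Nonempty E := nonempty_of_isProbabilityMeasure Q
  have hbdd : BddBelow (Set.range f) := ⟨-K, by rintro _ ⟨x, rfl⟩; exact (abs_le.1 (hK x)).1⟩
  have hIcc : ∀ x, f x ∈ Set.Icc (⨅ y, f y) ((⨅ y, f y) + c) := fun x =>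
    ⟨ciInf_le hbdd x, by
      have : f x - c ≤ ⨅ y, f y := le_ciInf fun y => by linarith [hc x y]
      linarith⟩
  have h := (hasSubgaussianMGF_of_mem_Icc (μ := Q) hf.aemeasurable
    (Eventually.of_forall hIcc)).mgf_le s
  simp only [mgf] at h
  have e : ∀ x, Real.exp (s * f x)
      = Real.exp (s * ∫ y, f y ∂Q) * Real.exp (s * (f x - ∫ y, f y ∂Q)) := by
    intro x; rw [← Real.exp_add]; ring_nf
  simp_rw [e]
  rw [integral_const_mul, Real.exp_add]
  refine mul_le_mul_of_nonneg_left (h.trans (Real.exp_le_exp.2 (le_of_eq ?_))) (Real.exp_pos _).le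
  simp [abs_of_nonneg hc0]
  ring

/-- The moment generating function of a function with bounded differences. -/
theorem integral_exp_le_of_bounded_differences {E : Type*} [MeasurableSpace E] {Q : Measure E}
    [IsProbabilityMeasure Q] {c K : ℝ} (hc0 : 0 ≤ c) (s : ℝ) (n : ℕ) :
    ∀ (f : (Fin n → E) → ℝ), Measurable f → (∀ S, |f S| ≤ K) →
    (∀ S i x, |f (Function.update S i x) - f S| ≤ c) →
    ∫ S, Real.exp (s * f S) ∂(Measure.pi fun _ => Q)
      ≤ Real.exp (s * ∫ S, f S ∂(Measure.pi fun _ => Q) + n * (s ^ 2 * c ^ 2 / 8)) := by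
  induction n with
  | zero =>
    intro f _ _ _
    have h : ∀ S : Fin 0 → E, f S = f Fin.elim0 := fun S => congrArg f (Subsingleton.elim _ _)
    simp only [h]
    simp
  | succ n ih =>
    intro f hf hK hc
    have hmp := measurePreserving_cons (fun _ : Fin (n + 1) => Q)
    set F : E × (Fin n → E) → ℝ := fun r => f (Fin.cons r.1 r.2) with hF
    have hFm : Measurable F := hf.comp hmp.measurable
    have hint : ∀ g : (Fin (n + 1) → E) → ℝ, Measurable g → ∀ K', (∀ S, |g S| ≤ K') →
        ∫ S, g S ∂(Measure.pi fun _ => Q)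
          = ∫ y, ∫ x, g (Fin.cons x y) ∂Q ∂(Measure.pi fun _ : Fin n => Q) := by
      intro g hg K' hK'
      rw [← hmp.map_eq, integral_map hmp.measurable.aemeasurable hg.aestronglyMeasurable]
      exact integral_prod_symm _ (integrable_of_measurable_of_abs_le (hg.comp hmp.measurable)
        fun x => hK' _)
    have hexpK : ∀ S, |Real.exp (s * f S)| ≤ Real.exp (|s| * K) := by
      intro S
      rw [abs_of_pos (Real.exp_pos _), Real.exp_le_exp]
      calc s * f S ≤ |s| * |f S| := by rw [← abs_mul]; exact le_abs_self _
        _ ≤ |s| * K := mul_le_mul_of_nonneg_left (hK S) (abs_nonneg s)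
    rw [hint _ (hf.const_mul s).exp _ hexpK, hint _ hf _ hK]
    -- Integrating out the first coordinate preserves the bounded differences, and Hoeffding's lemma
    -- on each section costs one factor exp(s^2c^2/8).
    set g : (Fin n → E) → ℝ := fun y => ∫ x, F (x, y) ∂Q with hg
    have hgm : Measurable g :=
      (hFm.stronglyMeasurable.integral_prod_left' (μ := Q)).measurable
    have hgK : ∀ y, |g y| ≤ K := fun y => abs_integral_le_of_abs_le fun x => hK _
    have hFi : ∀ y, Integrable (fun x => F (x, y)) Q := fun y =>
      integrable_of_measurable_of_abs_le (hFm.comp (by fun_prop)) fun x => hK _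
    have hgc : ∀ S i x, |g (Function.update S i x) - g S| ≤ c := by
      intro S i x
      simp only [hg]
      rw [← integral_sub (hFi _) (hFi _)]
      refine abs_integral_le_of_abs_le fun x' => ?_
      simp only [hF]
      rw [Fin.cons_update]
      exact hc _ _ _
    have h1 : ∀ y, ∫ x, Real.exp (s * f (Fin.cons x y)) ∂Q
        ≤ Real.exp (s * g y) * Real.exp (s ^ 2 * c ^ 2 / 8) := by
      intro y
      rw [← Real.exp_add]
      refine integral_exp_le_of_abs_sub_le (f := fun x => F (x, y)) (hFm.comp (by fun_prop))
        (fun x => hK _) hc0 (fun x x' => ?_) s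
      have := hc (Fin.cons x' y : Fin (n + 1) → E) 0 x
      rw [Fin.update_cons_zero] at this
      exact (le_abs_self _).trans this
    have hgexp : Integrable (fun y => Real.exp (s * g y)) (Measure.pi fun _ : Fin n => Q) := by
      refine integrable_of_measurable_of_abs_le (K := Real.exp (|s| * K))
        (hgm.const_mul s).exp fun y => ?_
      rw [abs_of_pos (Real.exp_pos _), Real.exp_le_exp]
      calc s * g y ≤ |s| * |g y| := by rw [← abs_mul]; exact le_abs_self _
        _ ≤ |s| * K := mul_le_mul_of_nonneg_left (hgK y) (abs_nonneg s)
    have hL : Integrable (fun y => ∫ x, Real.exp (s * f (Fin.cons x y)) ∂Q)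
        (Measure.pi fun _ : Fin n => Q) := by
      refine integrable_of_measurable_of_abs_le (K := Real.exp (|s| * K)) ?_ fun y =>
        abs_integral_le_of_abs_le fun x => hexpK _
      exact ((hFm.const_mul s).exp.stronglyMeasurable.integral_prod_left' (μ := Q)).measurable
    calc ∫ y, ∫ x, Real.exp (s * f (Fin.cons x y)) ∂Q ∂(Measure.pi fun _ : Fin n => Q)
        ≤ ∫ y, Real.exp (s * g y) * Real.exp (s ^ 2 * c ^ 2 / 8)
            ∂(Measure.pi fun _ : Fin n => Q) := integral_mono hL (hgexp.mul_const _) h1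
      _ = (∫ y, Real.exp (s * g y) ∂(Measure.pi fun _ : Fin n => Q))
            * Real.exp (s ^ 2 * c ^ 2 / 8) := integral_mul_const _ _
      _ ≤ Real.exp (s * ∫ S, g S ∂(Measure.pi fun _ => Q) + n * (s ^ 2 * c ^ 2 / 8))
            * Real.exp (s ^ 2 * c ^ 2 / 8) :=
          mul_le_mul_of_nonneg_right (ih g hgm hgK hgc) (Real.exp_pos _).le
      _ = _ := by
          rw [← Real.exp_add]; congr 1; push_cast; ring

/-- **McDiarmid's inequality** for independent identically distributed coordinates. -/
theorem measure_ge_le_of_bounded_differences {E : Type*} [MeasurableSpace E] {Q : Measure E}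
    [IsProbabilityMeasure Q] {c K : ℝ} (hc0 : 0 ≤ c) {n : ℕ} {f : (Fin n → E) → ℝ}
    (hf : Measurable f) (hK : ∀ S, |f S| ≤ K)
    (hc : ∀ S i x, |f (Function.update S i x) - f S| ≤ c) {t : ℝ} (ht : 0 ≤ t) :
    (Measure.pi fun _ => Q).real {S | t ≤ f S - ∫ S, f S ∂(Measure.pi fun _ => Q)}
      ≤ Real.exp (-t ^ 2 / (2 * (n * (c ^ 2 / 4)))) := by
  set A := ∫ S, f S ∂(Measure.pi fun _ => Q)
  have hnn : 0 ≤ (n : ℝ) * (c ^ 2 / 4) := by positivity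
  have hcoe : (((n : ℝ) * (c ^ 2 / 4)).toNNReal : ℝ) = n * (c ^ 2 / 4) := Real.coe_toNNReal _ hnn
  have hsub : HasSubgaussianMGF (fun S => f S - A) ((n : ℝ) * (c ^ 2 / 4)).toNNReal
      (Measure.pi fun _ => Q) := by
    have e : ∀ s S, Real.exp (s * (f S - A)) = Real.exp (-(s * A)) * Real.exp (s * f S) := by
      intro s S; rw [← Real.exp_add]; ring_nf
    refine ⟨fun s => ?_, fun s => ?_⟩
    · simp_rw [e]
      refine (integrable_of_measurable_of_abs_le (K := Real.exp (|s| * K))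
        (hf.const_mul s).exp fun S => ?_).const_mul _
      rw [abs_of_pos (Real.exp_pos _), Real.exp_le_exp]
      calc s * f S ≤ |s| * |f S| := by rw [← abs_mul]; exact le_abs_self _
        _ ≤ |s| * K := mul_le_mul_of_nonneg_left (hK S) (abs_nonneg s)
    · simp only [mgf]
      simp_rw [e]
      rw [integral_const_mul]
      refine (mul_le_mul_of_nonneg_left
        (integral_exp_le_of_bounded_differences hc0 s n f hf hK hc) (Real.exp_pos _).le).trans_eq ?_
      rw [← Real.exp_add, hcoe]
      congr 1; ring
  have := hsub.measure_ge_le ht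
  rwa [hcoe] at this

variable {E γ : Type*} [MeasurableSpace E]

theorem abs_sup'_le {W : Finset γ} (hW : W.Nonempty) {f : γ → ℝ} {K : ℝ}
    (h : ∀ w ∈ W, |f w| ≤ K) : |W.sup' hW f| ≤ K := by
  obtain ⟨w, hw, e⟩ := Finset.exists_mem_eq_sup' hW f
  rw [e]; exact h w hw

theorem measurable_sup'_of_forall {α : Type*} [MeasurableSpace α] {W : Finset γ}
    (hW : W.Nonempty) {f : γ → α → ℝ} (h : ∀ w ∈ W, Measurable (f w)) :
    Measurable fun x => W.sup' hW fun w => f w x := by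
  have := Finset.measurable_sup' hW h
  convert this using 1
  funext x
  rw [Finset.sup'_apply]

theorem sup'_integral_le {α : Type*} [MeasurableSpace α] {μ : Measure α} [IsFiniteMeasure μ]
    {W : Finset γ} (hW : W.Nonempty) {f : γ → α → ℝ} {K : ℝ} (hf : ∀ w ∈ W, Measurable (f w))
    (hK : ∀ w ∈ W, ∀ x, |f w x| ≤ K) :
    (W.sup' hW fun w => ∫ x, f w x ∂μ) ≤ ∫ x, W.sup' hW (fun w => f w x) ∂μ := by
  refine Finset.sup'_le _ _ fun w hw => ?_
  refine integral_mono (integrable_of_measurable_of_abs_le (hf w hw) (hK w hw))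
    (integrable_of_measurable_of_abs_le (measurable_sup'_of_forall hW hf) fun x =>
      abs_sup'_le hW fun w hw => hK w hw x) fun x => ?_
  exact Finset.le_sup' (fun w => f w x) hw

/-- Symmetrization: the expected uniform deviation is at most twice any bound on the empirical
Rademacher averages. -/
theorem integral_sup'_deviation_le {Q : Measure E} [IsProbabilityMeasure Q] {W : Finset γ}
    (hW : W.Nonempty) {G : γ → E → ℝ} {M : ℝ} (hG : ∀ w ∈ W, Measurable (G w))
    (hM : ∀ w ∈ W, ∀ x, |G w x| ≤ M) {n : ℕ} {R : ℝ}
    (hR : ∀ S : Fin n → E,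
      signAvg (fun ε => W.sup' hW fun w => ∑ i, boolSign (ε i) * G w (S i)) ≤ R) :
    ∫ S, W.sup' hW (fun w => ∑ i, (∫ x, G w x ∂Q - G w (S i))) ∂(Measure.pi fun _ : Fin n => Q)
      ≤ 2 * R := by
  classical
  set π : Measure (Fin n → E) := Measure.pi fun _ => Q with hπ
  set π2 : Measure (Fin n → E × E) := Measure.pi fun _ => Q.prod Q with hπ2
  set H : ((Fin n → E) × (Fin n → E)) → ℝ := fun r =>
    W.sup' hW fun w => ∑ i, (G w (r.2 i) - G w (r.1 i)) with hH
  have hGi : ∀ w ∈ W, ∀ i, Measurable fun S : Fin n → E => G w (S i) := fun w hw i =>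
    (hG w hw).comp (measurable_pi_apply i)
  have hdiff : ∀ w ∈ W, ∀ x y, |G w x - G w y| ≤ 2 * M := fun w hw x y =>
    (abs_sub _ _).trans (by linarith [hM w hw x, hM w hw y])
  have hsumb : ∀ a : Fin n → ℝ, (∀ i, |a i| ≤ 2 * M) → |∑ i, a i| ≤ n * (2 * M) := by
    intro a ha
    refine (Finset.abs_sum_le_sum_abs _ _).trans ?_
    refine (Finset.sum_le_card_nsmul _ _ _ fun i _ => ha i).trans_eq ?_
    simp
  have hHm : Measurable H := measurable_sup'_of_forall hW fun w hw =>
    Finset.measurable_sum _ fun i _ => ((hG w hw).comp (by fun_prop)).sub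
      ((hG w hw).comp (by fun_prop))
  have hHb : ∀ r, |H r| ≤ n * (2 * M) := fun r =>
    abs_sup'_le hW fun w hw => hsumb _ fun i => hdiff w hw _ _
  -- replace the mean by an independent copy of the sample
  have step1 : ∫ S, W.sup' hW (fun w => ∑ i, (∫ x, G w x ∂Q - G w (S i))) ∂π
      ≤ ∫ r, H r ∂(π.prod π) := by
    rw [integral_prod _ (integrable_of_measurable_of_abs_le hHm hHb)]
    refine integral_mono ?_ ?_ fun S => ?_
    · refine integrable_of_measurable_of_abs_le (K := n * (2 * M))
        (measurable_sup'_of_forall hW fun w hw => Finset.measurable_sum _ fun i _ =>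
          measurable_const.sub (hGi w hw i)) fun S =>
        abs_sup'_le hW fun w hw => hsumb _ fun i => (abs_sub _ _).trans ?_
      have := abs_integral_le_of_abs_le (μ := Q) (hM w hw)
      linarith [hM w hw (S i)]
    · refine integrable_of_measurable_of_abs_le (K := n * (2 * M))
        (hHm.stronglyMeasurable.integral_prod_right' (ν := π)).measurable fun S =>
        abs_integral_le_of_abs_le fun S' => hHb _
    · have hint : ∀ w ∈ W, ∑ i, (∫ x, G w x ∂Q - G w (S i))
          = ∫ S', ∑ i, (G w (S' i) - G w (S i)) ∂π := by
        intro w hw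
        have hi : ∀ i : Fin n, Integrable (fun S' : Fin n → E => G w (S' i)) π := fun i =>
          integrable_of_measurable_of_abs_le ((hG w hw).comp (by fun_prop)) fun S' => hM w hw _
        rw [integral_finsetSum (f := fun i (S' : Fin n → E) => G w (S' i) - G w (S i)) _
          fun i _ => (hi i).sub (integrable_const _)]
        refine Finset.sum_congr rfl fun i _ => ?_
        rw [integral_sub (hi i) (integrable_const _)]
        congr 1
        · have hmp := measurePreserving_eval (fun _ : Fin n => Q) i
          rw [← hmp.map_eq, integral_map hmp.measurable.aemeasurable (hG w hw).aestronglyMeasurable]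
        · simp
      refine (le_of_eq (Finset.sup'_congr hW rfl hint)).trans ?_
      exact sup'_integral_le (f := fun w (S' : Fin n → E) => ∑ i, (G w (S' i) - G w (S i))) hW
        (fun w hw => Finset.measurable_sum _ fun i _ => (hGi w hw i).sub measurable_const)
        fun w hw S' => hsumb _ fun i => hdiff w hw _ _
  -- exchange the two copies in the coordinates with a negative sign
  set Hs : (Fin n → Bool) → (Fin n → E × E) → ℝ := fun ε T =>
    W.sup' hW fun w => ∑ i, boolSign (ε i) * (G w (T i).2 - G w (T i).1) with hHs
  have hHsm : ∀ ε, Measurable (Hs ε) := fun ε => measurable_sup'_of_forall hW fun w hw =>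
    Finset.measurable_sum _ fun i _ => (((hG w hw).comp (by fun_prop)).sub
      ((hG w hw).comp (by fun_prop))).const_mul _
  have hHsb : ∀ ε T, |Hs ε T| ≤ n * (2 * M) := fun ε T =>
    abs_sup'_le hW fun w hw => hsumb _ fun i => by
      rw [abs_mul, abs_boolSign, one_mul]; exact hdiff w hw _ _
  have step2 : ∫ r, H r ∂(π.prod π) = ∫ T, Hs (fun _ => true) T ∂π2 := by
    have hmp := measurePreserving_arrowProdEquivProdArrow E E (Fin n) (fun _ => Q) (fun _ => Q)
    rw [hπ, ← hmp.map_eq, integral_map hmp.measurable.aemeasurable hHm.aestronglyMeasurable]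
    refine integral_congr_ae (Eventually.of_forall fun T => ?_)
    simp [hH, hHs, boolSign, MeasurableEquiv.arrowProdEquivProdArrow,
      Equiv.arrowProdEquivProdArrow]
  have step3 : ∀ ε, ∫ T, Hs (fun _ => true) T ∂π2 = ∫ T, Hs ε T ∂π2 := by
    intro ε
    have hmp : MeasurePreserving (fun (T : Fin n → E × E) i =>
        (if ε i then id else Prod.swap) (T i)) π2 π2 := by
      refine measurePreserving_pi (fun _ => Q.prod Q) (fun _ => Q.prod Q) fun i => ?_
      split_ifs
      · exact MeasurePreserving.id _
      · exact Measure.measurePreserving_swap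
    conv_lhs => rw [← hmp.map_eq]
    rw [integral_map hmp.measurable.aemeasurable (hHsm _).aestronglyMeasurable]
    refine integral_congr_ae (Eventually.of_forall fun T => ?_)
    simp only [hHs]
    refine Finset.sup'_congr hW rfl fun w _ => Finset.sum_congr rfl fun i _ => ?_
    cases h : ε i <;> simp [boolSign]
  have step4 : ∫ T, Hs (fun _ => true) T ∂π2 = ∫ T, signAvg (fun ε => Hs ε T) ∂π2 := by
    have : signAvg (fun ε => ∫ T, Hs ε T ∂π2) = ∫ T, signAvg (fun ε => Hs ε T) ∂π2 := by
      simp only [signAvg]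
      rw [integral_div, integral_finsetSum _ fun ε _ =>
        integrable_of_measurable_of_abs_le (hHsm ε) (hHsb ε)]
    rw [← this, ← signAvg_const (ι := Fin n) (∫ T, Hs (fun _ => true) T ∂π2)]
    congr 1
    funext ε
    exact step3 ε
  -- The two copies are separated. The first carries opposite signs, which have the same
  -- distribution, so each copy contributes at most R.
  have step5 : ∀ T, signAvg (fun ε => Hs ε T) ≤ 2 * R := by
    intro T
    set U : (Fin n → E) → (Fin n → Bool) → ℝ := fun S ε =>
      W.sup' hW fun w => ∑ i, boolSign (ε i) * G w (S i) with hU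
    calc signAvg (fun ε => Hs ε T)
        ≤ signAvg (fun ε => U (fun i => (T i).2) ε + U (fun i => (T i).1) fun i => !ε i) := by
          refine signAvg_mono fun ε => Finset.sup'_le _ _ fun w hw => ?_
          have h1 := Finset.le_sup' (fun w => ∑ i, boolSign (ε i) * G w (T i).2) hw
          have h2 := Finset.le_sup' (fun w => ∑ i, boolSign (!ε i) * G w (T i).1) hw
          refine le_trans (le_of_eq ?_) (add_le_add h1 h2)
          rw [← Finset.sum_add_distrib]
          exact Finset.sum_congr rfl fun i _ => by rw [boolSign_not]; ring
      _ = signAvg (U fun i => (T i).2) + signAvg (U fun i => (T i).1) := by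
          rw [signAvg_add, signAvg_not (U fun i => (T i).1)]
      _ ≤ 2 * R := by linarith [hR fun i => (T i).2, hR fun i => (T i).1]
  rw [step2, step4] at step1
  refine step1.trans ?_
  refine (integral_mono (g := fun _ => 2 * R) ?_ (integrable_const _) step5).trans (by simp)
  refine integrable_of_measurable_of_abs_le (K := n * (2 * M)) ?_ fun T => ?_
  · exact (Finset.measurable_sum _ fun ε _ => hHsm ε).div_const _
  · have h1 : signAvg (fun ε => Hs ε T) ≤ n * (2 * M) := by
      have := signAvg_mono fun ε => (abs_le.1 (hHsb ε T)).2
      rwa [signAvg_const] at this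
    have h2 : -(n * (2 * M)) ≤ signAvg (fun ε => Hs ε T) := by
      have := signAvg_mono fun ε => (abs_le.1 (hHsb ε T)).1
      rwa [signAvg_const] at this
    exact abs_le.2 ⟨h2, h1⟩

/-- Uniform one-sided deviations of averages of independent identically distributed variables,
in terms of a bound on the empirical Rademacher averages. -/
theorem measure_exists_deviation_le {Q : Measure E} [IsProbabilityMeasure Q] {W : Finset γ}
    {G : γ → E → ℝ} {M : ℝ} (hM0 : 0 < M) (hG : ∀ w ∈ W, Measurable (G w))
    (hM : ∀ w ∈ W, ∀ x, G w x ∈ Set.Icc 0 M) {n : ℕ} (hn : 0 < n) {R : ℝ}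
    (hR : ∀ (hW : W.Nonempty) (S : Fin n → E),
      signAvg (fun ε => W.sup' hW fun w => ∑ i, boolSign (ε i) * G w (S i)) ≤ R)
    {t : ℝ} (ht : 0 ≤ t) :
    (Measure.pi fun _ : Fin n => Q)
        {S | ∃ w ∈ W, 2 * R / n + t < ∫ x, G w x ∂Q - (∑ i, G w (S i)) / n}
      ≤ ENNReal.ofReal (Real.exp (-2 * n * t ^ 2 / M ^ 2)) := by
  rcases W.eq_empty_or_nonempty with rfl | hW
  · simp
  have hn' : (0 : ℝ) < n := by exact_mod_cast hn
  have habs : ∀ w ∈ W, ∀ x, |G w x| ≤ M := fun w hw x =>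
    abs_le.2 ⟨by linarith [(hM w hw x).1], (hM w hw x).2⟩
  set f : (Fin n → E) → ℝ := fun S =>
    W.sup' hW fun w => ∑ i, (∫ x, G w x ∂Q - G w (S i)) with hf
  have hfm : Measurable f := measurable_sup'_of_forall hW fun w hw =>
    Finset.measurable_sum _ fun i _ => measurable_const.sub ((hG w hw).comp (by fun_prop))
  have hfb : ∀ S, |f S| ≤ n * (2 * M) := by
    intro S
    refine abs_sup'_le hW fun w hw => (Finset.abs_sum_le_sum_abs _ _).trans ?_
    refine (Finset.sum_le_card_nsmul _ _ (2 * M) fun i _ => (abs_sub _ _).trans ?_).trans_eq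
      (by simp)
    have := abs_integral_le_of_abs_le (μ := Q) (habs w hw)
    linarith [habs w hw (S i)]
  -- Only the i-th summand changes, by G w (S i) - G w x. Both values lie in [0, M], which gives M
  -- where bounds by absolute value would give 2M.
  have hfd1 : ∀ S i x, f (Function.update S i x) - f S ≤ M := by
    intro S i x
    rw [sub_le_iff_le_add]
    refine Finset.sup'_le _ _ fun w hw => ?_
    have h1 := Finset.le_sup' (fun w => ∑ i, (∫ x, G w x ∂Q - G w (S i))) hw
    have h2 : ∑ j, (∫ x, G w x ∂Q - G w (Function.update S i x j))
        - ∑ j, (∫ x, G w x ∂Q - G w (S j)) = G w (S i) - G w x := by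
      rw [← Finset.sum_sub_distrib, Finset.sum_eq_single i]
      · simp
      · intro j _ hj; simp [Function.update_of_ne hj]
      · simp
    have h3 := (hM w hw (S i)).2
    have h4 := (hM w hw x).1
    simp only [hf]
    linarith
  have hfd : ∀ S i x, |f (Function.update S i x) - f S| ≤ M := by
    intro S i x
    refine abs_le.2 ⟨?_, hfd1 S i x⟩
    have := hfd1 (Function.update S i x) i (S i)
    rw [Function.update_idem, Function.update_eq_self] at this
    linarith
  have hE := integral_sup'_deviation_le (Q := Q) hW hG habs (hR hW)
  have hmc := measure_ge_le_of_bounded_differences (Q := Q) hM0.le hfm hfb hfd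
    (t := n * t) (by positivity)
  refine (measure_mono ?_).trans ((ofReal_measureReal (measure_ne_top _ _)).symm.le.trans
    (ENNReal.ofReal_le_ofReal (hmc.trans_eq ?_)))
  · rintro S ⟨w, hw, h⟩
    have h1 := Finset.le_sup' (fun w => ∑ i, (∫ x, G w x ∂Q - G w (S i))) hw
    have h2 : ∑ i, (∫ x, G w x ∂Q - G w (S i)) = n * (∫ x, G w x ∂Q - (∑ i, G w (S i)) / n) := by
      rw [Finset.sum_sub_distrib]; simp; field_simp
    have h3 := mul_lt_mul_of_pos_left h hn'
    have h4 : (n : ℝ) * (2 * R / n + t) = 2 * R + n * t := by field_simp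
    change n * t ≤ f S - _
    simp only [h2] at h1
    have h5 : n * (∫ x, G w x ∂Q - (∑ i, G w (S i)) / n) ≤ f S := by
      rw [← h2]
      exact Finset.le_sup' (fun w => ∑ i, (∫ x, G w x ∂Q - G w (S i))) hw
    linarith
  · congr 1
    field_simp
    ring

end StructuredPrediction

/-! ### From β-mixing to independent blocks -/

namespace StructuredPrediction

/-- `μ` exceeds `ν` by at most `c` on every measurable set. -/
def ExceedsByAtMost {α : Type*} [MeasurableSpace α] (c : ℝ≥0∞) (μ ν : Measure α) : Prop :=
  ∀ A, MeasurableSet A → μ A ≤ ν A + c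

/-- A set whose sections over the first coordinate take finitely many values. -/
def simpleSet {α β : Type*} [MeasurableSpace α] (s : SimpleFunc α (Set β)) : Set (α × β) := {r | r.2 ∈ s r.1}

theorem simpleSet_eq_biUnion {α β : Type*} [MeasurableSpace α] (s : SimpleFunc α (Set β)) :
    simpleSet s = ⋃ B ∈ s.range, (s ⁻¹' {B}) ×ˢ B := by
  ext ⟨x, y⟩
  simp only [simpleSet, Set.mem_ofPred_eq, Set.mem_iUnion, Set.mem_prod, Set.mem_preimage,
    Set.mem_singleton_iff, exists_prop]
  exact ⟨fun h => ⟨s x, s.mem_range_self x, rfl, h⟩, fun ⟨B, _, h1, h2⟩ => h1 ▸ h2⟩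

section Exceeds

variable {α β : Type*} [MeasurableSpace α] [MeasurableSpace β]

theorem ExceedsByAtMost.trans {c c' : ℝ≥0∞} {μ ν ξ : Measure α} (h : ExceedsByAtMost c μ ν)
    (h' : ExceedsByAtMost c' ν ξ) : ExceedsByAtMost (c' + c) μ ξ := fun A hA =>
  (h A hA).trans (by rw [← add_assoc]; exact add_le_add_left (h' A hA) c)

theorem ExceedsByAtMost.map {c : ℝ≥0∞} {μ ν : Measure α} (h : ExceedsByAtMost c μ ν) {f : α → β}
    (hf : Measurable f) : ExceedsByAtMost c (μ.map f) (ν.map f) := fun A hA => by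
  rw [Measure.map_apply hf hA, Measure.map_apply hf hA]
  exact h _ (hf hA)

theorem ExceedsByAtMost.prod_left {c : ℝ≥0∞} {μ ν : Measure α} [SFinite μ] [SFinite ν]
    (h : ExceedsByAtMost c μ ν) (ξ : Measure β) [IsProbabilityMeasure ξ] :
    ExceedsByAtMost c (μ.prod ξ) (ν.prod ξ) := fun A hA => by
  rw [Measure.prod_apply_symm hA, Measure.prod_apply_symm hA]
  calc ∫⁻ y, μ ((fun x => (x, y)) ⁻¹' A) ∂ξ
      ≤ ∫⁻ y, (ν ((fun x => (x, y)) ⁻¹' A) + c) ∂ξ :=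
        lintegral_mono fun y => h _ (measurable_prodMk_right hA)
    _ = _ := by rw [lintegral_add_right _ measurable_const]; simp

theorem ExceedsByAtMost.prod_right {c : ℝ≥0∞} {μ ν : Measure β} [SFinite μ] [SFinite ν]
    (h : ExceedsByAtMost c μ ν) (ξ : Measure α) [IsProbabilityMeasure ξ] :
    ExceedsByAtMost c (ξ.prod μ) (ξ.prod ν) := fun A hA => by
  rw [Measure.prod_apply hA, Measure.prod_apply hA]
  calc ∫⁻ x, μ (Prod.mk x ⁻¹' A) ∂ξ
      ≤ ∫⁻ x, (ν (Prod.mk x ⁻¹' A) + c) ∂ξ :=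
        lintegral_mono fun y => h _ (measurable_prodMk_left hA)
    _ = _ := by rw [lintegral_add_right _ measurable_const]; simp

/-- A hybrid argument: the factors are exchanged one at a time, each at cost c. -/
theorem ExceedsByAtMost.pi {c : ℝ≥0∞} {μ ν : Measure α} [IsProbabilityMeasure μ]
    [IsProbabilityMeasure ν] (h : ExceedsByAtMost c μ ν) (n : ℕ) :
    ExceedsByAtMost (n * c) (Measure.pi fun _ : Fin n => μ) (Measure.pi fun _ : Fin n => ν) := by
  induction n with
  | zero =>
    intro A _
    rcases A.eq_empty_or_nonempty with rfl | hA
    · simp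
    · rw [Subsingleton.eq_univ_of_nonempty hA]; simp
  | succ n ih =>
    have h1 := measurePreserving_cons (fun _ : Fin (n + 1) => μ)
    have h2 := measurePreserving_cons (fun _ : Fin (n + 1) => ν)
    have := ((h.prod_left (Measure.pi fun _ : Fin n => μ)).trans
      (ih.prod_right ν)).map h1.measurable
    rw [h1.map_eq, h2.map_eq] at this
    convert this using 1
    push_cast; ring

theorem measurableSet_simpleSet {s : SimpleFunc α (Set β)} (hs : ∀ x, MeasurableSet (s x)) :
    MeasurableSet (simpleSet s) := by
  rw [simpleSet_eq_biUnion]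
  refine Finset.measurableSet_biUnion _ fun B hB => (s.measurableSet_preimage _).prod ?_
  obtain ⟨x, rfl⟩ := SimpleFunc.mem_range.1 hB
  exact hs x

theorem isSetRing_simpleSet :
    IsSetRing {A : Set (α × β) | ∃ s : SimpleFunc α (Set β), (∀ x, MeasurableSet (s x)) ∧
      A = simpleSet s} where
  empty_mem := ⟨SimpleFunc.const α ∅, by simp, by ext; simp [simpleSet]⟩
  union_mem := by
    rintro _ _ ⟨s, hs, rfl⟩ ⟨t, ht, rfl⟩
    exact ⟨(s.pair t).map fun r : Set β × Set β => r.1 ∪ r.2, fun x => (hs x).union (ht x), by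
      ext; simp [simpleSet]⟩
  sdiff_mem := by
    rintro _ _ ⟨s, hs, rfl⟩ ⟨t, ht, rfl⟩
    exact ⟨(s.pair t).map fun r : Set β × Set β => r.1 \ r.2, fun x => (hs x).diff (ht x), by
      ext; simp [simpleSet]⟩

theorem generateFrom_simpleSet :
    (inferInstance : MeasurableSpace (α × β)) = MeasurableSpace.generateFrom
      {A : Set (α × β) | ∃ s : SimpleFunc α (Set β), (∀ x, MeasurableSet (s x)) ∧
        A = simpleSet s} := by
  refine le_antisymm ?_ (MeasurableSpace.generateFrom_le ?_)
  · change Prod.instMeasurableSpace ≤ _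
    rw [← generateFrom_prod]
    refine MeasurableSpace.generateFrom_mono ?_
    rintro _ ⟨A, hA, B, hB, rfl⟩
    classical
    refine ⟨SimpleFunc.piecewise A hA (SimpleFunc.const α B) (SimpleFunc.const α ∅),
      fun x => ?_, ?_⟩
    · by_cases hx : x ∈ A
      · simpa [hx] using hB
      · simp [hx]
    · ext ⟨x, y⟩
      by_cases hx : x ∈ A <;> simp [simpleSet, hx]
  · rintro _ ⟨s, hs, rfl⟩
    exact measurableSet_simpleSet hs

/-- Approximation of A in the measure μ + ν gives one set that is close to A for both measures at
once. -/
theorem ExceedsByAtMost.of_simpleSet {c : ℝ≥0∞} {μ ν : Measure (α × β)} [IsFiniteMeasure μ]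
    [IsFiniteMeasure ν]
    (h : ∀ s : SimpleFunc α (Set β), (∀ x, MeasurableSet (s x)) →
      μ (simpleSet s) ≤ ν (simpleSet s) + c) : ExceedsByAtMost c μ ν := by
  intro A hA
  refine ENNReal.le_of_forall_pos_le_add fun ε hε _ => ?_
  have hε2 : (0 : ℝ≥0∞) < ε / 2 := by simp [hε.ne']
  obtain ⟨_, ⟨s, hs, rfl⟩, hlt⟩ := exists_measure_symmDiff_lt_of_generateFrom_isSetRing
    (μ := μ + ν) isSetRing_simpleSet
    ⟨{Set.univ}, Set.countable_singleton _, by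
      rintro _ rfl
      exact ⟨SimpleFunc.const α Set.univ, by simp, by ext; simp [simpleSet]⟩, by simp⟩
    generateFrom_simpleSet hA hε2
  rw [Measure.add_apply] at hlt
  have h1 : μ A ≤ μ (simpleSet s) + ε / 2 := by
    calc μ A ≤ μ (simpleSet s ∪ symmDiff (simpleSet s) A) := measure_mono fun x hx => by
          by_cases h : x ∈ simpleSet s
          · exact Or.inl h
          · exact Or.inr (Or.inr ⟨hx, h⟩)
      _ ≤ _ := (measure_union_le _ _).trans
          (add_le_add_right ((le_self_add.trans hlt.le)) _)
  have h2 : ν (simpleSet s) ≤ ν A + ε / 2 := by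
    calc ν (simpleSet s) ≤ ν (A ∪ symmDiff (simpleSet s) A) := measure_mono fun x hx => by
          by_cases h : x ∈ A
          · exact Or.inl h
          · exact Or.inr (Or.inl ⟨hx, h⟩)
      _ ≤ _ := (measure_union_le _ _).trans
          (add_le_add_right ((le_add_self.trans hlt.le)) _)
  calc μ A ≤ μ (simpleSet s) + ε / 2 := h1
    _ ≤ ν (simpleSet s) + c + ε / 2 := add_le_add_left (h s hs) _
    _ ≤ ν A + ε / 2 + c + ε / 2 := by gcongr
    _ = ν A + c + (ε / 2 + ε / 2) := by ring
    _ = ν A + c + ε := by rw [ENNReal.add_halves]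

end Exceeds

section Dependence

variable {Ω : Type*}

/-- P(A ∩ B) is the integral over A of the conditional probability of B. The error is kept as an
integral over A so that errors on disjoint sets, each with its own B, add up to at most a single ∫
g. -/
theorem measure_inter_le_of_condExp_dominated {𝓐 : MeasurableSpace Ω} [mΩ : MeasurableSpace Ω]
    (h𝓐 : 𝓐 ≤ mΩ) {P : Measure Ω} [IsProbabilityMeasure P] {A B : Set Ω}
    (hA : MeasurableSet[𝓐] A) (hB : MeasurableSet B) {g : Ω → ℝ≥0∞}
    (hg : ∀ᵐ ω ∂P, ENNReal.ofReal |(P⟦B | 𝓐⟧) ω - P.real B| ≤ g ω) :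
    P (A ∩ B) ≤ P A * P B + ∫⁻ ω in A, g ω ∂P := by
  have hA' : MeasurableSet A := h𝓐 A hA
  have hint : Integrable (B.indicator fun _ : Ω => (1 : ℝ)) P :=
    (integrable_const 1).indicator hB
  have h1 : ∫ ω in A, (P⟦B | 𝓐⟧) ω ∂P = P.real (A ∩ B) := by
    rw [setIntegral_condExp h𝓐 hint hA, setIntegral_indicator hB]
    simp
  have hnn : 0 ≤ᵐ[P.restrict A] P⟦B | 𝓐⟧ :=
    ae_restrict_of_ae (condExp_nonneg
      (Eventually.of_forall fun ω => Set.indicator_nonneg (fun _ _ => zero_le_one) ω))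
  have h2 : P (A ∩ B) = ∫⁻ ω in A, ENNReal.ofReal ((P⟦B | 𝓐⟧) ω) ∂P := by
    rw [← ofReal_integral_eq_lintegral_ofReal integrable_condExp.integrableOn hnn, h1,
      ofReal_measureReal]
  rw [h2]
  calc ∫⁻ ω in A, ENNReal.ofReal ((P⟦B | 𝓐⟧) ω) ∂P
      ≤ ∫⁻ ω in A, (P B + g ω) ∂P := by
        refine lintegral_mono_ae (ae_restrict_of_ae ?_)
        filter_upwards [hg] with ω hω
        refine le_trans ?_ (add_le_add_right hω (P B))
        rw [← ofReal_measureReal (μ := P) (s := B), ← ENNReal.ofReal_add measureReal_nonneg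
          (abs_nonneg _)]
        exact ENNReal.ofReal_le_ofReal (by linarith [le_abs_self ((P⟦B | 𝓐⟧) ω - P.real B)])
    _ = P A * P B + ∫⁻ ω in A, g ω ∂P := by
        rw [lintegral_add_left measurable_const]
        simp [mul_comm]

/-- The joint law of two random variables exceeds the product of their laws by at most the
dependence coefficient of the `σ`-algebras they are measurable for. -/
theorem exceedsByAtMost_map_prodMk {α β : Type*} [MeasurableSpace α] [MeasurableSpace β]
    {𝓐 𝓑 : MeasurableSpace Ω} [mΩ : MeasurableSpace Ω] (h𝓐 : 𝓐 ≤ mΩ) (h𝓑 : 𝓑 ≤ mΩ)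
    {P : Measure Ω} [IsProbabilityMeasure P] {U : Ω → α} {V : Ω → β} (hU : Measurable[𝓐] U)
    (hV : Measurable[𝓑] V) :
    ExceedsByAtMost (betaDependence 𝓐 𝓑 P) (P.map fun ω => (U ω, V ω))
      ((P.map U).prod (P.map V)) := by
  have hU' : Measurable U := hU.mono h𝓐 le_rfl
  have hV' : Measurable V := hV.mono h𝓑 le_rfl
  have hUV : Measurable fun ω => (U ω, V ω) := hU'.prodMk hV'
  have : IsProbabilityMeasure (P.map U) := Measure.isProbabilityMeasure_map hU'.aemeasurable
  have : IsProbabilityMeasure (P.map V) := Measure.isProbabilityMeasure_map hV'.aemeasurable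
  have hkey : ∀ g : Ω → ℝ≥0∞, (∀ B : Set Ω, MeasurableSet[𝓑] B →
      ∀ᵐ ω ∂P, ENNReal.ofReal |(P⟦B | 𝓐⟧) ω - P.real B| ≤ g ω) →
      ExceedsByAtMost (∫⁻ ω, g ω ∂P) (P.map fun ω => (U ω, V ω)) ((P.map U).prod (P.map V)) := by
    intro g hg
    refine ExceedsByAtMost.of_simpleSet fun s hs => ?_
    have hsB : ∀ B ∈ s.range, MeasurableSet B := fun B hB => by
      obtain ⟨x, rfl⟩ := SimpleFunc.mem_range.1 hB
      exact hs x
    have hdisj : (↑s.range : Set (Set β)).PairwiseDisjoint fun B => s ⁻¹' {B} := by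
      intro B _ B' _ hne
      exact Set.disjoint_left.2 fun x hx hx' => hne (hx.symm.trans hx')
    rw [simpleSet_eq_biUnion, measure_biUnion_finset (fun B hB B' hB' hne =>
        Set.disjoint_prod.2 (Or.inl (hdisj hB hB' hne)))
        fun B hB => (s.measurableSet_preimage _).prod (hsB B hB),
      measure_biUnion_finset (fun B hB B' hB' hne =>
        Set.disjoint_prod.2 (Or.inl (hdisj hB hB' hne)))
        fun B hB => (s.measurableSet_preimage _).prod (hsB B hB)]
    have h1 : ∀ B ∈ s.range, (P.map fun ω => (U ω, V ω)) ((s ⁻¹' {B}) ×ˢ B)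
        ≤ ((P.map U).prod (P.map V)) ((s ⁻¹' {B}) ×ˢ B)
          + ∫⁻ ω in U ⁻¹' (s ⁻¹' {B}), g ω ∂P := by
      intro B hB
      rw [Measure.prod_prod, Measure.map_apply hUV ((s.measurableSet_preimage _).prod (hsB B hB)),
        Measure.map_apply hU' (s.measurableSet_preimage _), Measure.map_apply hV' (hsB B hB)]
      exact measure_inter_le_of_condExp_dominated h𝓐 (hU (s.measurableSet_preimage _))
        (hV' (hsB B hB)) (hg _ (hV (hsB B hB)))
    refine (Finset.sum_le_sum h1).trans ?_
    rw [Finset.sum_add_distrib]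
    refine add_le_add_right ?_ _
    rw [← lintegral_biUnion_finset (fun B hB B' hB' hne => (hdisj hB hB' hne).preimage U)
      fun B hB => hU' (s.measurableSet_preimage _)]
    exact setLIntegral_le_lintegral _ _
  intro A hA
  rw [betaDependence, ENNReal.add_iInf]
  refine le_iInf fun g => ?_
  by_cases hg : g ∈ {g : Ω → ℝ≥0∞ | Measurable[mΩ] g ∧ ∀ B : Set Ω, MeasurableSet[𝓑] B →
      ∀ᵐ ω ∂P, ENNReal.ofReal |(P⟦B | 𝓐⟧) ω - P.real B| ≤ g ω}
  · rw [iInf_pos hg]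
    exact hkey g hg.2 A hA
  · rw [iInf_neg hg]; simp

/-- Conditional probabilities lie in [0, 1], so the constant 1 is an admissible dominating function.
The resulting finiteness makes `toReal` harmless in the main theorem. -/
theorem betaDependence_le_one {𝓐 𝓑 : MeasurableSpace Ω} [mΩ : MeasurableSpace Ω]
    (h𝓐 : 𝓐 ≤ mΩ) (h𝓑 : 𝓑 ≤ mΩ) (P : Measure Ω) [IsProbabilityMeasure P] :
    betaDependence 𝓐 𝓑 P ≤ 1 := by
  refine (iInf₂_le (fun _ => 1) ⟨measurable_const, fun B hB => ?_⟩).trans (by simp)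
  have hint : Integrable (B.indicator fun _ : Ω => (1 : ℝ)) P :=
    (integrable_const 1).indicator (h𝓑 B hB)
  have h0 : 0 ≤ᵐ[P] P⟦B | 𝓐⟧ := condExp_nonneg
    (Eventually.of_forall fun ω => Set.indicator_nonneg (fun _ _ => zero_le_one) ω)
  have h1 : P⟦B | 𝓐⟧ ≤ᵐ[P] fun _ => (1 : ℝ) := by
    have := condExp_mono (m := 𝓐) hint (integrable_const (1 : ℝ)) (Eventually.of_forall fun ω =>
      Set.indicator_le_self' (s := B) (f := fun _ => (1 : ℝ)) (fun _ _ => zero_le_one) ω)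
    rwa [condExp_const h𝓐] at this
  filter_upwards [h0, h1] with ω h0 h1
  rw [ENNReal.ofReal_le_one]
  have h2 : P.real B ≤ 1 := measureReal_le_one
  have h3 : 0 ≤ P.real B := measureReal_nonneg
  simp only [Pi.zero_apply] at h0
  exact abs_le.2 ⟨by linarith, by linarith⟩

end Dependence

theorem measurePreserving_snoc {E : Type*} [MeasurableSpace E] {n : ℕ}
    (μ : Fin (n + 1) → Measure E) [∀ i, SigmaFinite (μ i)] :
    MeasurePreserving (fun r : (Fin n → E) × E => (Fin.snoc r.1 r.2 : Fin (n + 1) → E))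
      ((Measure.pi fun j : Fin n => μ j.castSucc).prod (μ (Fin.last n))) (Measure.pi μ) := by
  have h := (measurePreserving_piFinSuccAbove μ (Fin.last n)).symm
  simp only [Fin.succAbove_last] at h
  convert h.comp Measure.measurePreserving_swap using 1
  funext r
  simp [MeasurableEquiv.piFinSuccAbove]
  rfl

/-- The joint law of a finite sequence of weakly dependent variables exceeds the product of their
laws by at most the accumulated dependence. -/
theorem exceedsByAtMost_map_pi {Ω E : Type*} [MeasurableSpace Ω] [MeasurableSpace E]
    {P : Measure Ω} [IsProbabilityMeasure P] {V : ℕ → Ω → E} (hV : ∀ k, Measurable (V k))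
    {c : ℝ≥0∞}
    (hc : ∀ k, ExceedsByAtMost c (P.map fun ω => ((fun j : Fin (k + 1) => V j ω), V (k + 1) ω))
      ((P.map fun ω (j : Fin (k + 1)) => V j ω).prod (P.map (V (k + 1))))) (n : ℕ) :
    ExceedsByAtMost (n * c) (P.map fun ω (j : Fin (n + 1)) => V j ω)
      (Measure.pi fun j : Fin (n + 1) => P.map (V j)) := by
  have hprob : ∀ k, IsProbabilityMeasure (P.map (V k)) := fun k =>
    Measure.isProbabilityMeasure_map (hV k).aemeasurable
  have hm : ∀ k, Measurable fun ω (j : Fin k) => V j ω := fun k =>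
    measurable_pi_iff.2 fun j => hV j
  induction n with
  | zero =>
    have : (Measure.pi fun j : Fin 1 => P.map (V j)) = P.map fun ω (j : Fin 1) => V j ω := by
      refine Measure.pi_eq fun s hs => ?_
      rw [Measure.map_apply (hm 1) (MeasurableSet.univ_pi hs)]
      simp only [Finset.univ_unique, Finset.prod_singleton]
      rw [Measure.map_apply (hV _) (hs _)]
      congr 1
      ext ω
      simp [Set.mem_pi, Fin.forall_fin_one]
    intro A _
    rw [this]
    exact le_self_add
  | succ n ih =>
    have hsn := measurePreserving_snoc fun j : Fin (n + 1 + 1) => P.map (V j)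
    -- The last variable is detached from the earlier ones at cost c, and the earlier ones are
    -- already decoupled by induction.
    have h1 := (hc n).trans (ih.prod_left (P.map (V (n + 1))))
    have h2 := h1.map hsn.measurable
    have e1 : Measure.map (fun r : (Fin (n + 1) → E) × E =>
        (Fin.snoc r.1 r.2 : Fin (n + 1 + 1) → E))
        (P.map fun ω => ((fun j : Fin (n + 1) => V j ω), V (n + 1) ω))
          = P.map fun ω (j : Fin (n + 1 + 1)) => V j ω := by
      rw [Measure.map_map hsn.measurable ((hm _).prodMk (hV _))]
      congr 1
      funext ω
      funext j
      refine Fin.lastCases ?_ (fun j => ?_) j <;> simp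
    have e2 := hsn.map_eq
    simp only [Fin.val_castSucc, Fin.val_last] at e2
    rw [e1, e2] at h2
    convert h2 using 1
    push_cast; ring

section MixingProcess

theorem measurable_pastSigma {Ω Z : Type*} [MeasurableSpace Z] {ζ : ℤ → Ω → Z} {L : ℕ} {k : ℤ} (h1 : 1 ≤ k) (h2 : k ≤ L) :
    Measurable[pastSigma ζ L] (ζ k) :=
  Measurable.mono (comap_measurable (ζ k))
    (le_iSup₂ (f := fun (k : ℤ) (_ : k ∈ Set.Icc (1 : ℤ) (L : ℤ)) =>
      MeasurableSpace.comap (ζ k) inferInstance) k ⟨h1, h2⟩) le_rfl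

theorem measurable_futureSigma {Ω Z : Type*} [MeasurableSpace Z] {ζ : ℤ → Ω → Z} {N : ℕ} {k : ℤ} (h : (N : ℤ) ≤ k) :
    Measurable[futureSigma ζ N] (ζ k) :=
  Measurable.mono (comap_measurable (ζ k))
    (le_iSup₂ (f := fun (k : ℤ) (_ : k ∈ Set.Ici (N : ℤ)) =>
      MeasurableSpace.comap (ζ k) inferInstance) k h) le_rfl

variable {Ω Z : Type*} [MeasurableSpace Ω] [MeasurableSpace Z] {P : Measure Ω} {ζ : ℤ → Ω → Z}

theorem pastSigma_le (hζ : ∀ k, Measurable (ζ k)) (L : ℕ) :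
    pastSigma ζ L ≤ (inferInstance : MeasurableSpace Ω) :=
  iSup₂_le fun k _ => (hζ k).comap_le

theorem futureSigma_le (hζ : ∀ k, Measurable (ζ k)) (N : ℕ) :
    futureSigma ζ N ≤ (inferInstance : MeasurableSpace Ω) :=
  iSup₂_le fun k _ => (hζ k).comap_le

theorem betaCoeff_le_one [IsProbabilityMeasure P] (hζ : ∀ k, Measurable (ζ k)) (a : ℕ) :
    betaCoeff P ζ a ≤ 1 :=
  iSup₂_le fun L _ => betaDependence_le_one (pastSigma_le hζ L) (futureSigma_le hζ (L + a)) P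

/-- The `k`-th block of length `a` of a process, counted from `0`. -/
def block (ζ : ℤ → Ω → Z) (a k : ℕ) (ω : Ω) : Fin a → Z :=
  fun j => ζ (((k * a + j : ℕ) : ℤ) + 1) ω

theorem measurable_block (hζ : ∀ k, Measurable (ζ k)) (a k : ℕ) : Measurable (block ζ a k) :=
  measurable_pi_iff.2 fun _ => hζ _

theorem map_block_eq (hst : IsStationary P ζ) (a k : ℕ) :
    P.map (block ζ a k) = P.map (block ζ a 0) := by
  have h := (hst ((k * a : ℕ) : ℤ)).comp
    (u := fun (z : ℤ → Z) (j : Fin a) => z ((j : ℤ) + 1)) (by fun_prop)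
  convert h.map_eq using 2
  · funext ω j
    simp only [block, Function.comp]
    congr 1; push_cast; ring
  · funext ω j
    simp [block]

/-- Every second block of a `β`-mixing process: their joint law exceeds the law of independent
blocks by at most the accumulated mixing coefficients. -/
theorem exceedsByAtMost_map_blocks [IsProbabilityMeasure P] (hζ : ∀ k, Measurable (ζ k))
    (hst : IsStationary P ζ) {a : ℕ} (ha : 0 < a) (e n : ℕ) :
    ExceedsByAtMost (n * betaCoeff P ζ a)
      (P.map fun ω (b : Fin (n + 1)) => block ζ a (2 * b + e) ω)
      (Measure.pi fun _ : Fin (n + 1) => P.map (block ζ a 0)) := by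
  have h := exceedsByAtMost_map_pi (P := P) (V := fun b => block ζ a (2 * b + e))
    (fun b => measurable_block hζ a _) (c := betaCoeff P ζ a) (fun k => ?_) n
  · simpa only [map_block_eq hst a (2 * _ + e)] using h
  -- Block number r occupies the times ra + 1, …, ra + a. Hence L is the last time of block 2k + e,
  -- and the next block of that parity begins at L + a + 1, inside the future from L + a on.
  · set L := (2 * k + e + 1) * a with hL
    have hL1 : 1 ≤ L := Nat.mul_pos (Nat.succ_pos _) ha
    have hdep := exceedsByAtMost_map_prodMk (P := P) (pastSigma_le hζ L)
      (futureSigma_le hζ (L + a))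
      (U := fun ω (j : Fin (k + 1)) => block ζ a (2 * j + e) ω)
      (V := block ζ a (2 * (k + 1) + e)) ?_ ?_
    · intro A hA
      refine (hdep A hA).trans (add_le_add_right ?_ _)
      exact le_iSup₂ (f := fun (L : ℕ) (_ : L ∈ Set.Ici 1) =>
        betaDependence (pastSigma ζ L) (futureSigma ζ (L + a)) P) L hL1
    · refine @measurable_pi_iff _ _ _ (_) _ _ |>.2 fun j => @measurable_pi_iff _ _ _ (_) _ _ |>.2
        fun i => measurable_pastSigma (by omega) ?_
      have h1 : (2 * (j : ℕ) + e) * a + i + 1 ≤ L := by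
        have hj : (j : ℕ) ≤ k := Nat.lt_succ_iff.1 j.2
        calc (2 * (j : ℕ) + e) * a + i + 1 ≤ (2 * (j : ℕ) + e) * a + a := by
              have := i.2; omega
          _ = (2 * (j : ℕ) + e + 1) * a := by ring
          _ ≤ L := Nat.mul_le_mul_right _ (by omega)
      exact_mod_cast h1
    · refine @measurable_pi_iff _ _ _ (_) _ _ |>.2 fun i => measurable_futureSigma ?_
      have h1 : L + a ≤ (2 * (k + 1) + e) * a + i + 1 := by
        have : L + a = (2 * (k + 1) + e) * a := by rw [hL]; ring
        omega
      exact_mod_cast h1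

end MixingProcess

end StructuredPrediction

/-! ### Splitting documents into even and odd blocks -/

namespace StructuredPrediction

theorem sum_range_two_mul_blocks (F : ℕ → ℝ) (a n : ℕ) :
    ∑ k ∈ Finset.range (2 * a * n), F k
      = ∑ b ∈ Finset.range n, ∑ j ∈ Finset.range a, F ((2 * b + 0) * a + j)
        + ∑ b ∈ Finset.range n, ∑ j ∈ Finset.range a, F ((2 * b + 1) * a + j) := by
  induction n with
  | zero => simp
  | succ n ih =>
    rw [Finset.sum_range_succ, Finset.sum_range_succ, show 2 * a * (n + 1) = 2 * a * n + a + a by ring,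
      Finset.sum_range_add, Finset.sum_range_add, ih]
    have e0 : ∑ j ∈ Finset.range a, F (2 * a * n + j)
        = ∑ j ∈ Finset.range a, F ((2 * n + 0) * a + j) :=
      Finset.sum_congr rfl fun j _ => by congr 1; ring
    have e1 : ∑ j ∈ Finset.range a, F (2 * a * n + a + j)
        = ∑ j ∈ Finset.range a, F ((2 * n + 1) * a + j) :=
      Finset.sum_congr rfl fun j _ => by congr 1; ring
    rw [e0, e1]
    abel

theorem block_index_lt {J a n : ℕ} (hJ : J = 2 * a * n) {e : ℕ} (he : e < 2) (b : Fin n)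
    (j : Fin a) : (2 * (b : ℕ) + e) * a + j < J := by
  calc (2 * (b : ℕ) + e) * a + j < (2 * (b : ℕ) + e) * a + a := by have := j.2; omega
    _ = (2 * (b : ℕ) + e + 1) * a := by ring
    _ ≤ (2 * n) * a := Nat.mul_le_mul_right _ (by have := b.2; omega)
    _ = J := by rw [hJ]; ring

/-- The blocks of length `a` with index of parity `e` in a document. -/
def docBlocks {Z : Type*} {J a n : ℕ} (hJ : J = 2 * a * n) {e : ℕ} (he : e < 2)
    (S : Fin J → Z) (b : Fin n) (j : Fin a) : Z :=
  S ⟨(2 * (b : ℕ) + e) * a + j, block_index_lt hJ he b j⟩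

theorem sum_eq_sum_docBlocks {Z : Type*} {J a n : ℕ} (hJ : J = 2 * a * n) (g : Z → ℝ)
    (S : Fin J → Z) :
    ∑ j, g (S j) = ∑ b, ∑ j, g (docBlocks hJ (e := 0) (by norm_num) S b j)
      + ∑ b, ∑ j, g (docBlocks hJ (e := 1) (by norm_num) S b j) := by
  set F : ℕ → ℝ := fun k => if h : k < J then g (S ⟨k, h⟩) else 0 with hF
  have h1 : ∑ j, g (S j) = ∑ k ∈ Finset.range (2 * a * n), F k := by
    rw [← hJ, ← Fin.sum_univ_eq_sum_range]
    exact Finset.sum_congr rfl fun j _ => by simp [hF]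
  have h2 : ∀ (e : ℕ) (he : e < 2), ∑ b, ∑ j, g (docBlocks hJ he S b j)
      = ∑ b ∈ Finset.range n, ∑ j ∈ Finset.range a, F ((2 * b + e) * a + j) := by
    intro e he
    rw [← Fin.sum_univ_eq_sum_range (fun b => ∑ j ∈ Finset.range a, F ((2 * b + e) * a + j))]
    refine Finset.sum_congr rfl fun b _ => ?_
    rw [← Fin.sum_univ_eq_sum_range (fun j => F ((2 * (b : ℕ) + e) * a + j))]
    refine Finset.sum_congr rfl fun j _ => ?_
    simp only [hF, dif_pos (block_index_lt hJ he b j), docBlocks]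
  rw [h1, h2, h2, sum_range_two_mul_blocks]

theorem integral_comp_process_eq {Z Ω₀ : Type*} [MeasurableSpace Z] [MeasurableSpace Ω₀]
    {P : Measure Ω₀} {ζ : ℤ → Ω₀ → Z} (hst : IsStationary P ζ)
    {g : Z → ℝ} (hg : Measurable g) (k : ℤ) :
    ∫ ω, g (ζ k ω) ∂P = ∫ ω, g (ζ 0 ω) ∂P := by
  have h := (hst k).comp (u := fun z : ℤ → Z => g (z 0)) (by fun_prop)
  simpa [Function.comp_def] using h.integral_eq

section Blocks

variable {Z Ω Ω₀ : Type*} [MeasurableSpace Z] [MeasurableSpace Ω] [MeasurableSpace Ω₀]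
  {μ : Measure Ω} [IsProbabilityMeasure μ] {P : Measure Ω₀} [IsProbabilityMeasure P]
  {ζ : ℤ → Ω₀ → Z} {m J a n : ℕ} {D : Fin m → Ω → Fin J → Z}

omit [IsProbabilityMeasure μ] in
/-- Transfer from the blocks of the sample to independent blocks. -/
theorem measure_docBlocks_mem_le (hζ : ∀ k, Measurable (ζ k)) (hst : IsStationary P ζ)
    (ha : 0 < a) (hJ : J = 2 * a * (n + 1)) (hD : ∀ i, Measurable (D i)) (hind : iIndepFun D μ)
    (hlaw : ∀ i, IdentDistrib (D i) (fun ω (j : Fin J) => ζ ((j : ℤ) + 1) ω) μ P)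
    {e : ℕ} (he : e < 2) {A : Set (Fin (m * (n + 1)) → Fin a → Z)} (hA : MeasurableSet A) :
    μ {ω | (fun t => docBlocks hJ he (D (finProdFinEquiv.symm t).1 ω) (finProdFinEquiv.symm t).2)
        ∈ A}
      ≤ (Measure.pi fun _ => P.map (block ζ a 0)) A + m * (n * betaCoeff P ζ a) := by
  have hblk : ∀ k, Measurable (block ζ a k) := measurable_block hζ a
  have : IsProbabilityMeasure (P.map (block ζ a 0)) :=
    Measure.isProbabilityMeasure_map (hblk 0).aemeasurable
  set ν := P.map fun ω (b : Fin (n + 1)) => block ζ a (2 * b + e) ω with hν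
  have hνm : Measurable fun ω (b : Fin (n + 1)) => block ζ a (2 * b + e) ω :=
    measurable_pi_iff.2 fun b => hblk _
  have : IsProbabilityMeasure ν := Measure.isProbabilityMeasure_map hνm.aemeasurable
  have hτ : Measurable (docBlocks (Z := Z) hJ he) := by
    unfold docBlocks; fun_prop
  have hmap : ∀ i, μ.map (fun ω => docBlocks hJ he (D i ω)) = ν := by
    intro i
    have h := ((hlaw i).comp hτ).map_eq
    refine h.trans ?_
    rw [hν]
    congr 1
  have hjoint : μ.map (fun ω i => docBlocks hJ he (D i ω)) = Measure.pi fun _ : Fin m => ν := by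
    have h := (hind.comp (fun _ => docBlocks hJ he) fun _ => hτ).map_fun_eq_pi_map
      fun i => (hτ.comp (hD i)).aemeasurable
    refine h.trans ?_
    congr 1
    funext i
    exact hmap i
  have hfl := measurePreserving_flatten (finProdFinEquiv (m := m) (n := n + 1)).symm
    (P.map (block ζ a 0))
  -- The n + 1 blocks of one document cost n coefficients, since the first block is free.
  -- Independence of the documents multiplies this by m.
  have hex := (exceedsByAtMost_map_blocks (P := P) hζ hst ha e n).pi m
  have h := hex _ (hfl.measurable hA)
  have hm' : Measurable fun ω i => docBlocks hJ he (D i ω) :=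
    measurable_pi_iff.2 fun i => hτ.comp (hD i)
  rw [hfl.measure_preimage hA.nullMeasurableSet, ← hν, ← hjoint,
    Measure.map_apply hm' (hfl.measurable hA)] at h
  exact h

theorem integral_block_average (hζ : ∀ k, Measurable (ζ k)) (hst : IsStationary P ζ)
    (ha : 0 < a) {g : Z → ℝ} (hg : Measurable g) {M : ℝ} (hM : ∀ z, |g z| ≤ M) :
    ∫ x, (∑ j, g (x j)) / a ∂(P.map (block ζ a 0)) = ∫ ω, g (ζ 0 ω) ∂P := by
  have hm : Measurable fun x : Fin a → Z => (∑ j, g (x j)) / (a : ℝ) :=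
    (Finset.measurable_sum _ fun j _ => hg.comp (measurable_pi_apply j)).div_const _
  rw [integral_map (measurable_block hζ a 0).aemeasurable hm.aestronglyMeasurable, integral_div,
    integral_finsetSum (f := fun (j : Fin a) ω => g (block ζ a 0 ω j)) _ fun j _ =>
      integrable_of_measurable_of_abs_le (hg.comp (hζ _)) fun ω => hM _]
  have : ∀ j : Fin a, ∫ ω, g (block ζ a 0 ω j) ∂P = ∫ ω, g (ζ 0 ω) ∂P := fun j =>
    integral_comp_process_eq hst hg _
  simp only [this]
  have ha' : (a : ℝ) ≠ 0 := by exact_mod_cast ha.ne'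
  simp; field_simp

omit [IsProbabilityMeasure P] in
-- Stationarity gives every token the law of ζ^0, so this mean agrees with that of a block average.
-- The true risk is thus also the centring for independent blocks.
theorem integral_sample_average (hst : IsStationary P ζ)
    (hm : 0 < m) (hJ : 0 < J) (hD : ∀ i, Measurable (D i))
    (hlaw : ∀ i, IdentDistrib (D i) (fun ω (j : Fin J) => ζ ((j : ℤ) + 1) ω) μ P)
    {g : Z → ℝ} (hg : Measurable g) {M : ℝ} (hM : ∀ z, |g z| ≤ M) :
    ∫ ω, 1 / ((m : ℝ) * (J : ℝ)) * ∑ i, ∑ j, g (D i ω j) ∂μ = ∫ ω, g (ζ 0 ω) ∂P := by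
  have hmeas : ∀ i j, Measurable fun ω => g (D i ω j) := fun i j =>
    hg.comp ((measurable_pi_apply j).comp (hD i))
  have hint : ∀ i j, Integrable (fun ω => g (D i ω j)) μ := fun i j =>
    integrable_of_measurable_of_abs_le (hmeas i j) fun ω => hM _
  rw [integral_const_mul, integral_finsetSum _ fun i _ => integrable_finsetSum _ fun j _ => hint i j]
  have : ∀ i, ∫ ω, ∑ j, g (D i ω j) ∂μ = J * ∫ ω, g (ζ 0 ω) ∂P := by
    intro i
    rw [integral_finsetSum _ fun j _ => hint i j]
    have h1 : ∀ j, ∫ ω, g (D i ω j) ∂μ = ∫ ω, g (ζ 0 ω) ∂P := by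
      intro j
      have h := (hlaw i).comp (u := fun z : Fin J → Z => g (z j)) (by fun_prop)
      refine Eq.trans ?_ (integral_comp_process_eq hst hg ((j : ℤ) + 1))
      simpa [Function.comp_def] using h.integral_eq
    simp [h1]
  simp only [this]
  have hm' : (m : ℝ) ≠ 0 := by exact_mod_cast hm.ne'
  have hJ' : (J : ℝ) ≠ 0 := by exact_mod_cast hJ.ne'
  simp; field_simp

omit [IsProbabilityMeasure μ] in
/-- Uniform deviations over a finite class for documents drawn from a `β`-mixing process. -/
theorem measure_exists_sample_deviation_le (hζ : ∀ k, Measurable (ζ k)) (hst : IsStationary P ζ)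
    (ha : 0 < a) (hm : 0 < m) (hJ : J = 2 * a * (n + 1)) (hD : ∀ i, Measurable (D i))
    (hind : iIndepFun D μ)
    (hlaw : ∀ i, IdentDistrib (D i) (fun ω (j : Fin J) => ζ ((j : ℤ) + 1) ω) μ P)
    {γ : Type*} {W : Finset γ} {g : γ → Z → ℝ} {M : ℝ} (hM0 : 0 < M)
    (hg : ∀ w ∈ W, Measurable (g w)) (hM : ∀ w ∈ W, ∀ z, g w z ∈ Set.Icc 0 M) {R : ℝ}
    (hR : ∀ (hW : W.Nonempty) (S : Fin (m * (n + 1)) → Fin a → Z),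
      signAvg (fun ε => W.sup' hW fun w => ∑ i, boolSign (ε i) * ((∑ j, g w (S i j)) / a)) ≤ R)
    {t : ℝ} (ht : 0 ≤ t) :
    μ {ω | ∃ w ∈ W, 2 * R / (m * (n + 1) : ℕ) + t
        < ∫ ω, g w (ζ 0 ω) ∂P - 1 / ((m : ℝ) * (J : ℝ)) * ∑ i, ∑ j, g w (D i ω j)}
      ≤ 2 * (ENNReal.ofReal (Real.exp (-2 * (m * (n + 1) : ℕ) * t ^ 2 / M ^ 2))
          + m * (n * betaCoeff P ζ a)) := by
  have ha' : (0 : ℝ) < a := by exact_mod_cast ha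
  have hN : 0 < m * (n + 1) := Nat.mul_pos hm (Nat.succ_pos n)
  have hN' : (0 : ℝ) < (m * (n + 1) : ℕ) := by exact_mod_cast hN
  set Q := P.map (block ζ a 0) with hQ
  have : IsProbabilityMeasure Q :=
    Measure.isProbabilityMeasure_map (measurable_block hζ a 0).aemeasurable
  set G : γ → (Fin a → Z) → ℝ := fun w x => (∑ j, g w (x j)) / a with hG
  have hGm : ∀ w ∈ W, Measurable (G w) := fun w hw =>
    (Finset.measurable_sum _ fun j _ => (hg w hw).comp (measurable_pi_apply j)).div_const _
  have hGM : ∀ w ∈ W, ∀ x, G w x ∈ Set.Icc 0 M := by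
    intro w hw x
    refine ⟨div_nonneg (Finset.sum_nonneg fun j _ => (hM w hw _).1) ha'.le, ?_⟩
    rw [hG]; simp only
    rw [div_le_iff₀ ha']
    refine (Finset.sum_le_card_nsmul _ _ M fun j _ => (hM w hw _).2).trans_eq ?_
    simp [mul_comm]
  have hGint : ∀ w ∈ W, ∫ x, G w x ∂Q = ∫ ω, g w (ζ 0 ω) ∂P := fun w hw =>
    integral_block_average hζ hst ha (hg w hw) (M := M) fun z =>
      abs_le.2 ⟨by linarith [(hM w hw z).1], (hM w hw z).2⟩
  set A : Set (Fin (m * (n + 1)) → Fin a → Z) := {S | ∃ w ∈ W,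
    2 * R / (m * (n + 1) : ℕ) + t < ∫ x, G w x ∂Q - (∑ i, G w (S i)) / (m * (n + 1) : ℕ)} with hA
  have hAm : MeasurableSet A := by
    have : A = ⋃ w ∈ W, {S | 2 * R / (m * (n + 1) : ℕ) + t
        < ∫ x, G w x ∂Q - (∑ i, G w (S i)) / (m * (n + 1) : ℕ)} := by
      ext S; simp [hA]
    rw [this]
    refine Finset.measurableSet_biUnion _ fun w hw => measurableSet_lt measurable_const ?_
    exact measurable_const.sub ((Finset.measurable_sum _ fun i _ =>
      (hGm w hw).comp (measurable_pi_apply i)).div_const _)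
  have hAle := measure_exists_deviation_le (Q := Q) hM0 hGm hGM hN hR ht
  have htr : ∀ (e : ℕ) (he : e < 2), μ {ω | (fun t => docBlocks hJ he
      (D (finProdFinEquiv.symm t).1 ω) (finProdFinEquiv.symm t).2) ∈ A}
      ≤ ENNReal.ofReal (Real.exp (-2 * (m * (n + 1) : ℕ) * t ^ 2 / M ^ 2))
          + m * (n * betaCoeff P ζ a) := fun e he =>
    (measure_docBlocks_mem_le hζ hst ha hJ hD hind hlaw he hAm).trans (add_le_add_left hAle _)
  refine (measure_mono ?_).trans ((measure_union_le _ _).trans ((add_le_add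
    (htr 0 (by norm_num)) (htr 1 (by norm_num))).trans_eq (two_mul _).symm))
  rintro ω ⟨w, hw, h⟩
  -- The sample average is the mean of the averages over the two parities, so if it falls short of
  -- the expectation by more than the threshold, so does one of them.
  set avg : ∀ e : ℕ, e < 2 → ℝ := fun e he => (∑ t, G w (docBlocks hJ he
    (D (finProdFinEquiv.symm t).1 ω) (finProdFinEquiv.symm t).2)) / (m * (n + 1) : ℕ) with havg
  have hsplit : 1 / ((m : ℝ) * (J : ℝ)) * ∑ i, ∑ j, g w (D i ω j)
      = (avg 0 (by norm_num) + avg 1 (by norm_num)) / 2 := by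
    have h1 : ∀ (e : ℕ) (he : e < 2), avg e he
        = (∑ i, ∑ b, ∑ j, g w (docBlocks hJ he (D i ω) b j)) / a / (m * (n + 1) : ℕ) := by
      intro e he
      simp only [havg, hG]
      rw [← Finset.sum_div, Equiv.sum_comp finProdFinEquiv.symm
        (fun r : Fin m × Fin (n + 1) => ∑ j, g w (docBlocks hJ he (D r.1 ω) r.2 j)),
        Fintype.sum_prod_type]
    rw [h1, h1]
    simp only [sum_eq_sum_docBlocks hJ (g w), Finset.sum_add_distrib]
    have hm' : (m : ℝ) ≠ 0 := by exact_mod_cast hm.ne'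
    have hJ' : (J : ℝ) = 2 * a * (n + 1) := by rw [hJ]; push_cast; ring
    rw [hJ']
    push_cast
    field_simp
  rw [hsplit, ← hGint w hw] at h
  by_contra hcon
  rw [Set.mem_union, not_or] at hcon
  have h0 := hcon.1
  have h1 := hcon.2
  simp only [hA, Set.mem_ofPred_eq, not_exists, not_and, not_lt] at h0 h1
  have h0 := h0 w hw
  have h1 := h1 w hw
  simp only [havg] at h
  linarith

end Blocks

end StructuredPrediction

/-! ### The margin loss, linear scores and the complexity term -/

namespace StructuredPrediction

section MarginLoss

variable {X 𝒴 : Type*} {L : 𝒴 → 𝒴 → ℝ} {ρ : ℝ}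

theorem maxLoss_nonneg (hL : ∀ y y', 0 ≤ L y y') : 0 ≤ maxLoss L :=
  Real.iSup_nonneg fun _ => hL _ _

theorem marginLoss_mem_Icc (hL : ∀ y y', 0 ≤ L y y') (h : X → 𝒴 → ℝ) (z : X × 𝒴) :
    marginLoss L ρ h z ∈ Set.Icc 0 (maxLoss L) :=
  ⟨le_min (maxLoss_nonneg hL) (le_max_left _ _), min_le_left _ _⟩

/-- Nonnegativity of c is needed for the empty index set, where both suprema are 0. This is the case
of a single label. -/
theorem ciSup_le_ciSup_add {ι : Type*} [Finite ι] {f g : ι → ℝ} {c : ℝ} (hc : 0 ≤ c)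
    (h : ∀ i, f i ≤ g i + c) : ⨆ i, f i ≤ (⨆ i, g i) + c := by
  rcases isEmpty_or_nonempty ι with hι | hι
  · simpa [Real.iSup_of_isEmpty] using hc
  · refine ciSup_le fun i => (h i).trans ?_
    gcongr
    exact le_ciSup (Set.finite_range g).bddAbove i

/-- A margin is a difference of two scores, so it moves by at most 2η. The maximum over labels and
the truncation to [0, M] are nonexpansive. -/
theorem abs_marginLoss_sub_le [Finite 𝒴] (hρ : 0 < ρ) {h h' : X → 𝒴 → ℝ} {z : X × 𝒴} {η : ℝ}
    (hη : ∀ y, |h z.1 y - h' z.1 y| ≤ η) :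
    |marginLoss L ρ h z - marginLoss L ρ h' z| ≤ 2 / ρ * η := by
  have hη0 : 0 ≤ η := (abs_nonneg _).trans (hη z.2)
  have hc : 0 ≤ 2 / ρ * η := by positivity
  have key : ∀ u v : X → 𝒴 → ℝ, (∀ y, |u z.1 y - v z.1 y| ≤ η) →
      marginLoss L ρ u z ≤ marginLoss L ρ v z + 2 / ρ * η := by
    intro u v huv
    have h1 : (⨆ y' : {y' : 𝒴 // y' ≠ z.2}, (L y' z.2 - 1 / ρ * (u z.1 z.2 - u z.1 y')))
        ≤ (⨆ y' : {y' : 𝒴 // y' ≠ z.2}, (L y' z.2 - 1 / ρ * (v z.1 z.2 - v z.1 y')))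
          + 2 / ρ * η := by
      refine ciSup_le_ciSup_add hc fun y' => ?_
      have h2 := abs_le.1 (huv z.2)
      have h3 := abs_le.1 (huv y')
      have h4 : (v z.1 z.2 - v z.1 y') - (u z.1 z.2 - u z.1 y') ≤ 2 * η := by linarith
      have h5 := mul_le_mul_of_nonneg_left h4 (show 0 ≤ 1 / ρ by positivity)
      have h6 : 1 / ρ * (2 * η) = 2 / ρ * η := by ring
      linarith
    unfold marginLoss
    rw [← min_add_add_right, ← max_add_add_right]
    exact min_le_min (by linarith) (max_le_max (by linarith) h1)
  refine abs_le.2 ⟨?_, ?_⟩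
  · linarith [key h' h fun y => by rw [abs_sub_comm]; exact hη y]
  · linarith [key h h' hη]

theorem measurable_marginLoss [MeasurableSpace X] [Finite 𝒴] [MeasurableSpace 𝒴]
    [MeasurableSingletonClass 𝒴] {h : X → 𝒴 → ℝ} (hh : ∀ y, Measurable fun x => h x y) :
    Measurable (marginLoss L ρ h) := by
  refine measurable_from_prod_countable_left fun y => ?_
  unfold marginLoss
  refine measurable_const.min (measurable_const.max ?_)
  exact Measurable.iSup (f := fun (y' : {y' : 𝒴 // y' ≠ y}) x =>
    L y' y - 1 / ρ * (h x y - h x y')) fun y' =>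
      measurable_const.sub (((hh y).sub (hh y')).const_mul _)

end MarginLoss

section Scoring

variable {l : ℕ} {F : Type*} [Fintype F] {G : FactorGraph l F} {X : Type*} {Y : Fin l → Type*}
  {D : ℕ} {Ψ : ∀ f : F, X → G.FactorLabel Y f → Fin D → ℝ}

/-- The linear scoring function `(x, y) ↦ ⟨w, Ψ(x, y)⟩`. -/
noncomputable def linearScore (Ψ : ∀ f : F, X → G.FactorLabel Y f → Fin D → ℝ) (w : Fin D → ℝ)
    (x : X) (y : ∀ k, Y k) : ℝ :=
  ∑ i, w i * feature G Ψ x y i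

theorem linearScore_eq_sum (w : Fin D → ℝ) (x : X) (y : ∀ k, Y k) :
    linearScore Ψ w x y = ∑ f, ∑ i, w i * Ψ f x (G.proj f y) i := by
  simp only [linearScore, feature, Finset.sum_apply, Finset.mul_sum]
  exact Finset.sum_comm

/-- Control factor by factor costs |F| in the Lipschitz constant, but only d labels per factor have
to be watched instead of all of 𝒴. -/
theorem abs_linearScore_sub_le {u v : Fin D → ℝ} {x : X} {η : ℝ}
    (h : ∀ f y, |∑ i, (u i - v i) * Ψ f x y i| ≤ η) (y : ∀ k, Y k) :
    |linearScore Ψ u x y - linearScore Ψ v x y| ≤ Fintype.card F * η := by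
  rw [linearScore_eq_sum, linearScore_eq_sum, ← Finset.sum_sub_distrib]
  refine (Finset.abs_sum_le_sum_abs _ _).trans ?_
  rw [← nsmul_eq_mul, ← Finset.card_univ]
  refine Finset.sum_le_card_nsmul _ _ _ fun f _ => ?_
  rw [← Finset.sum_sub_distrib]
  simpa only [sub_mul] using h f (G.proj f y)

theorem measurable_linearScore [MeasurableSpace X] (hΨ : ∀ f y, Measurable fun x => Ψ f x y)
    (w : Fin D → ℝ) (y : ∀ k, Y k) : Measurable fun x => linearScore Ψ w x y := by
  simp only [linearScore_eq_sum]
  exact Finset.measurable_sum _ fun f _ => Finset.measurable_sum _ fun i _ =>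
    ((measurable_pi_apply i).comp (hΨ f _)).const_mul _

omit [Fintype F] in
theorem featureBound_nonneg (q : ℝ) : 0 ≤ featureBound G Ψ q :=
  Real.sSup_nonneg (by rintro _ ⟨f, x, y, rfl⟩; exact pNorm_nonneg _ _)

omit [Fintype F] in
theorem pNorm_le_featureBound {q : ℝ} (h : BddAbove (featureNorms G Ψ q)) (f : F) (x : X)
    (y : G.FactorLabel Y f) : pNorm q (Ψ f x y) ≤ featureBound G Ψ q :=
  le_csSup h ⟨f, x, y, rfl⟩

theorem abs_marginLoss_linearScore_sub_le [∀ k, Finite (Y k)] {L : (∀ k, Y k) → (∀ k, Y k) → ℝ}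
    {ρ : ℝ} (hρ : 0 < ρ) {u v : Fin D → ℝ} {z : X × ∀ k, Y k} {η : ℝ}
    (h : ∀ f y, |∑ i, (u i - v i) * Ψ f z.1 y i| ≤ η) :
    |marginLoss L ρ (linearScore Ψ u) z - marginLoss L ρ (linearScore Ψ v) z|
      ≤ 2 * Fintype.card F / ρ * η := by
  refine (abs_marginLoss_sub_le hρ (η := Fintype.card F * η) fun y =>
    abs_linearScore_sub_le h y).trans_eq ?_
  ring

/-- The empirical Rademacher averages of the block averages of the margin loss. -/
theorem signAvg_sup'_marginLoss_le [∀ k, Finite (Y k)] {d : ℕ}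
    (hd : ∀ f, Nat.card (G.FactorLabel Y f) = d) (L : (∀ k, Y k) → (∀ k, Y k) → ℝ)
    {p q : ℝ} (hpq : p.HolderConjugate q) (hq : 2 ≤ q) {Λ ρ : ℝ} (hΛ : 0 ≤ Λ) (hρ : 0 < ρ)
    (hbdd : BddAbove (featureNorms G Ψ q)) {N a : ℕ} (ha : 0 < a) {A : ℝ} (hA : 0 < A)
    (hAlog : Real.log (2 * (N * a * d * Fintype.card F) + 1) ≤ A) (K : ℕ)
    {W : Finset (Fin D → ℝ)} (hWΛ : ∀ w ∈ W, pNorm p w ≤ Λ) (hW : W.Nonempty)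
    (S : Fin N → Fin a → X × ∀ k, Y k) :
    signAvg (fun ε => W.sup' hW fun w => ∑ i, boolSign (ε i) *
        ((∑ j, marginLoss L ρ (linearScore Ψ w) (S i j)) / a))
      ≤ K * (25 * (2 * Fintype.card F / ρ * (Λ * featureBound G Ψ q)) * √N * √((q - 1) * A))
        + N * (2 * Fintype.card F / ρ * (Λ * featureBound G Ψ q)) / 2 ^ K := by
  classical
  have ha' : (0 : ℝ) < a := by exact_mod_cast ha
  have : ∀ f, Fintype (G.FactorLabel Y f) := fun f => Fintype.ofFinite _
  have hcard : Fintype.card (Fin N × Fin a × Σ f, G.FactorLabel Y f)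
      = N * a * d * Fintype.card F := by
    simp only [Fintype.card_prod, Fintype.card_fin, Fintype.card_sigma]
    have : ∀ f, Fintype.card (G.FactorLabel Y f) = d := fun f => by
      rw [← hd f, Nat.card_eq_fintype_card]
    simp only [this]
    simp; ring
  -- The points to cover are the vectors Ψ_f(x, y) for all sampled inputs x, all factors f and all
  -- labels y of f, while the signs are indexed by the N blocks only.
  have h := signAvg_sup'_le_chaining (ι := Fin N) (κ := Fin N × Fin a × Σ f, G.FactorLabel Y f)
    hpq hq hΛ (featureBound_nonneg (Ψ := Ψ) q) (s := 2 * Fintype.card F / ρ) (by positivity)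
    (fun k => Ψ k.2.2.1 (S k.1 k.2.1).1 k.2.2.2) (fun k => pNorm_le_featureBound hbdd _ _ _) hA
    (by rw [hcard]; exact_mod_cast hAlog)
    (fun w i => (∑ j, marginLoss L ρ (linearScore Ψ w) (S i j)) / a)
    (fun u v η hη hη0 i => ?_) W hW hWΛ K
  · rw [Fintype.card_fin] at h
    exact h
  · rw [← sub_div, ← Finset.sum_sub_distrib, abs_div, abs_of_pos ha', div_le_iff₀ ha']
    refine (Finset.abs_sum_le_sum_abs _ _).trans ?_
    refine (Finset.sum_le_card_nsmul _ _ _ fun j _ =>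
      abs_marginLoss_linearScore_sub_le hρ fun f y => hη (i, j, ⟨f, y⟩)).trans_eq ?_
    simp; ring

end Scoring

theorem continuous_of_abs_sub_le_pNorm {D : ℕ} {p : ℝ} (hp : 0 < p) {f : (Fin D → ℝ) → ℝ} {c : ℝ}
    (h : ∀ u v, |f u - f v| ≤ c * pNorm p (fun i => u i - v i)) : Continuous f := by
  refine continuous_iff_continuousAt.2 fun v => ?_
  rw [ContinuousAt, tendsto_iff_dist_tendsto_zero]
  have hc : Continuous fun u : Fin D → ℝ => c * pNorm p (fun i => u i - v i) := by
    unfold pNorm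
    refine continuous_const.mul (Continuous.rpow_const ?_ fun _ => Or.inr (by positivity))
    exact continuous_finsetSum _ fun i _ => Continuous.rpow_const (by fun_prop)
      fun _ => Or.inr hp.le
  have h0 : Tendsto (fun u : Fin D → ℝ => c * pNorm p (fun i => u i - v i)) (𝓝 v) (𝓝 0) := by
    have := hc.tendsto v
    have e : (fun i => v i - v i) = (0 : Fin D → ℝ) := by funext i; simp
    rwa [e, pNorm_zero hp, mul_zero] at this
  refine squeeze_zero (fun _ => dist_nonneg) (fun u => ?_) h0
  rw [Real.dist_eq]
  exact h u v

/-- The complexity term is dominated by the term of the generalization bound. -/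
theorem complexity_term_le {n d N B Λ ρ Q : ℝ} {a b : ℕ} (ha : 0 < a) (hb : 0 < b)
    (hn : n = 2 * a * b) (hQ : 1 ≤ Q) (hB : 0 ≤ B) (hΛ : 0 ≤ Λ) (hρ : 0 < ρ) (hN : 0 ≤ N)
    (hdN : N ≠ 0 → 1 ≤ d ∧ 1 ≤ N) :
    2 * (Nat.clog 2 (2 * a * b) * (25 * (2 * N / ρ * (Λ * B)) * √b
        * √(Q * max 1 (Real.log (2 * n * d * N * (8 * B * Λ * n / ρ + 3) + 1))))
        + b * (2 * N / ρ * (Λ * B)) / 2 ^ Nat.clog 2 (2 * a * b)) / b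
      ≤ 306 * (√(2 * a * Q) * B * Λ * N / (ρ * √n) * logFactor n d N B Λ ρ) := by
  rcases eq_or_ne N 0 with rfl | hN0
  · simp
  obtain ⟨hd1, hN1⟩ := hdN hN0
  have ha' : (1 : ℝ) ≤ a := by exact_mod_cast ha
  have hb' : (1 : ℝ) ≤ b := by exact_mod_cast hb
  have hn2 : 2 ≤ n := by rw [hn]; nlinarith
  set k := Nat.clog 2 (2 * a * b) with hk
  set Lg := Real.log (2 * n * d * N * (8 * B * Λ * n / ρ + 3) + 1) with hLg
  -- The argument of the logarithm is at least 2 · 2 · 3 + 1 > e, so the maximum with 1 can be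
  -- dropped. The case N = 0, where this fails, has been removed.
  have hLg1 : 1 ≤ Lg := by
    rw [hLg, Real.le_log_iff_exp_le (by positivity)]
    have h1 : 0 ≤ 8 * B * Λ * n / ρ := by positivity
    have h2 : 2 ≤ n * d * N := by
      calc (2 : ℝ) = 2 * 1 * 1 := by norm_num
        _ ≤ n * d * N := by gcongr
    have h3 := Real.exp_one_lt_d9
    nlinarith
  rw [max_eq_right hLg1, logFactor, ← hLg]
  have hlog2 := Real.log_two_gt_d9
  have hlogn : Real.log 2 ≤ Real.log n := Real.log_le_log (by norm_num) hn2
  have hnat : ((2 * a * b : ℕ) : ℝ) = n := by rw [hn]; push_cast; ring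
  have hk1 : n ≤ 2 ^ k := by
    rw [← hnat]; exact_mod_cast Nat.le_pow_clog (by norm_num) _
  -- Both k - 1 and 1 are at most log n / log 2, and 2 / log 2 < 3.
  have hk2 : (k : ℝ) ≤ 3 * Real.log n := by
    have h2 : 1 < 2 * a * b := by
      have : 0 < a * b := Nat.mul_pos ha hb
      rw [mul_assoc]; omega
    have h3 : (2 : ℝ) ^ (k - 1) < n := by
      rw [← hnat]; exact_mod_cast Nat.pow_pred_clog_lt_self (by norm_num) h2
    have h4 : ((k - 1 : ℕ) : ℝ) * Real.log 2 ≤ Real.log n := by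
      rw [← Real.log_pow]
      exact Real.log_le_log (by positivity) h3.le
    have h5 : (k : ℝ) ≤ ((k - 1 : ℕ) : ℝ) + 1 := by
      exact_mod_cast (by omega : k ≤ k - 1 + 1)
    have h6 : (0 : ℝ) ≤ ((k - 1 : ℕ) : ℝ) := Nat.cast_nonneg _
    nlinarith
  have hsn : 0 < √n := Real.sqrt_pos.2 (by linarith)
  have hsnn : √n * √n = n := Real.mul_self_sqrt (by linarith)
  have hsb : √(b : ℝ) * √(b : ℝ) = b := Real.mul_self_sqrt (by linarith)
  have hsb0 : 0 < √(b : ℝ) := Real.sqrt_pos.2 (by linarith)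
  have hnab : √n = √(2 * a) * √b := by
    rw [← Real.sqrt_mul (by positivity)]; exact congrArg _ hn
  have h2a0 : 0 < √(2 * (a : ℝ)) := Real.sqrt_pos.2 (by linarith)
  set base := √(2 * a * Q) * B * Λ * N / (ρ * √n) with hbase
  have hbase0 : 0 ≤ base := by positivity
  have hsLg : 1 ≤ √Lg := Real.one_le_sqrt.2 hLg1
  -- Here 100 = 2 · 25 · 2. With k ≤ 3 log n this gives 300, and the truncation error adds 6 because
  -- 2^k ≥ n and log n ≥ 2/3.
  have e1 : 2 * (k * (25 * (2 * N / ρ * (Λ * B)) * √b * √(Q * Lg))) / b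
      = 100 * k * (base * √Lg) := by
    have key : ∀ s r c g k : ℝ, s ≠ 0 → r ≠ 0 →
        2 * (k * (25 * (2 * N / ρ * (Λ * B)) * r * (c * g))) / (r * r)
          = 100 * k * (s * c * B * Λ * N / (ρ * (s * r)) * g) := by
      intro s r c g k hs hr
      field_simp
      ring
    rw [hbase, hnab, Real.sqrt_mul (by positivity : (0 : ℝ) ≤ 2 * a),
      Real.sqrt_mul (by linarith : 0 ≤ Q), ← key _ _ _ _ _ h2a0.ne' hsb0.ne', hsb]
  have e2 : 2 * (b * (2 * N / ρ * (Λ * B)) / 2 ^ k) / b ≤ 4 * base := by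
    have h1 : 1 / (2 : ℝ) ^ k ≤ √(2 * a * Q) / √n := by
      rw [div_le_div_iff₀ (by positivity) hsn, one_mul]
      have h2 : 1 ≤ √(2 * a * Q) := Real.one_le_sqrt.2 (by nlinarith)
      have h3 : √n ≤ n := Real.sqrt_le_iff.2 ⟨by linarith, by nlinarith⟩
      calc √n ≤ 1 * 2 ^ k := by linarith
        _ ≤ √(2 * a * Q) * 2 ^ k := by gcongr
    calc 2 * (b * (2 * N / ρ * (Λ * B)) / 2 ^ k) / b
        = 4 * (N / ρ * (Λ * B)) * (1 / 2 ^ k) := by field_simp; ring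
      _ ≤ 4 * (N / ρ * (Λ * B)) * (√(2 * a * Q) / √n) := by gcongr
      _ = 4 * base := by rw [hbase]; field_simp
  rw [mul_add, add_div, e1]
  have h7 : 100 * k * (base * √Lg) ≤ 300 * Real.log n * (base * √Lg) := by
    have := mul_le_mul_of_nonneg_right hk2 (show 0 ≤ base * √Lg by positivity)
    linarith
  have h8 : 4 * base ≤ 6 * (base * √Lg * Real.log n) := by
    have h9 : 2 / 3 ≤ √Lg * Real.log n :=
      (by linarith : 2 / 3 ≤ Real.log n).trans (le_mul_of_one_le_left (by linarith) hsLg)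
    have h10 := mul_le_mul_of_nonneg_left h9 hbase0
    linarith
  have h9 := add_le_add h7 (e2.trans h8)
  have h10 : 300 * Real.log n * (base * √Lg) + 6 * (base * √Lg * Real.log n)
      = 306 * (base * (√Lg * Real.log n)) := by ring
  rw [h10] at h9
  exact h9

end StructuredPrediction

/-! ### Separability, confidence levels and the main theorem -/

namespace StructuredPrediction

/-- Passage from finite subclasses to a separable class. -/
theorem one_sub_le_measureReal_forall_le {Ω V : Type*} [MeasurableSpace Ω] {μ : Measure Ω}
    [IsProbabilityMeasure μ] [TopologicalSpace V] [TopologicalSpace.SeparableSpace V] [Nonempty V]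
    {E : V → Ω → ℝ} (hE : ∀ ω, Continuous fun w => E w ω) {c δ : ℝ} (hδ : 0 ≤ δ)
    (hfin : ∀ W : Finset V, μ {ω | ∃ w ∈ W, c < E w ω} ≤ ENNReal.ofReal δ) :
    1 - δ ≤ μ.real {ω | ∀ w, E w ω ≤ c} := by
  classical
  set u := TopologicalSpace.denseSeq V
  set bad : ℕ → Set Ω := fun n => {ω | ∃ w ∈ (Finset.range n).image u, c < E w ω} with hbad
  have hmono : Monotone bad := by
    rintro n n' hn ω ⟨w, hw, h⟩
    exact ⟨w, Finset.image_subset_image (Finset.range_mono hn) hw, h⟩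
  have h1 : μ (⋃ n, bad n) ≤ ENNReal.ofReal δ := by
    rw [hmono.measure_iUnion]
    exact iSup_le fun n => hfin _
  have h2 : Set.univ ⊆ (⋃ n, bad n) ∪ {ω | ∀ w, E w ω ≤ c} := by
    intro ω _
    by_cases h : ω ∈ ⋃ n, bad n
    · exact Or.inl h
    · refine Or.inr fun w => (TopologicalSpace.denseRange_denseSeq V).induction_on w
        (isClosed_le (hE ω) continuous_const) fun k => ?_
      by_contra! hk
      exact h (Set.mem_iUnion.2 ⟨k + 1, u k, Finset.mem_image_of_mem u (by simp), hk⟩)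
  have h3 : 1 ≤ ENNReal.ofReal δ + μ {ω | ∀ w, E w ω ≤ c} := by
    calc 1 = μ Set.univ := measure_univ.symm
      _ ≤ _ := (measure_mono h2).trans ((measure_union_le _ _).trans (add_le_add_left h1 _))
  rw [← ofReal_measureReal, ← ENNReal.ofReal_add hδ measureReal_nonneg, ← ENNReal.ofReal_one,
    ENNReal.ofReal_le_ofReal_iff (add_nonneg hδ measureReal_nonneg)] at h3
  linarith

/-- There are b = N/(2a) blocks per parity, and the deviation is tuned so that each of the two
parities fails with probability η/2. -/
theorem exp_deviation_eq {M η N : ℝ} {a b : ℕ} (hM : 0 < M) (ha : 0 < a) (hb : 0 < b)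
    (hN : N = 2 * a * b) (hη : 0 < η) (hη2 : η ≤ 2) :
    Real.exp (-2 * b * (M * √a * √(Real.log (2 / η)) / √N) ^ 2 / M ^ 2) = η / 2 := by
  have ha' : (0 : ℝ) < a := by exact_mod_cast ha
  have hb' : (0 : ℝ) < b := by exact_mod_cast hb
  have hlog : 0 ≤ Real.log (2 / η) := Real.log_nonneg (by rw [le_div_iff₀ hη]; linarith)
  have hN0 : 0 < N := by rw [hN]; positivity
  have h1 : -2 * b * (M * √a * √(Real.log (2 / η)) / √N) ^ 2 / M ^ 2 = -Real.log (2 / η) := by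
    rw [div_pow, mul_pow, mul_pow, Real.sq_sqrt ha'.le, Real.sq_sqrt hlog, Real.sq_sqrt hN0.le, hN]
    field_simp
  rw [h1, Real.exp_neg, Real.exp_log (by positivity), inv_div]

theorem ofReal_confidence_eq {η β : ℝ} {m n : ℕ} (hη : 0 ≤ η) (hβ : 0 ≤ β) :
    2 * (ENNReal.ofReal (η / 2) + m * (n * ENNReal.ofReal β))
      = ENNReal.ofReal (η + 2 * m * n * β) := by
  rw [← ENNReal.ofReal_natCast m, ← ENNReal.ofReal_natCast n, ← ENNReal.ofReal_mul (by positivity),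
    ← ENNReal.ofReal_mul (by positivity), ← ENNReal.ofReal_add (by positivity) (by positivity),
    show (2 : ℝ≥0∞) = ENNReal.ofReal 2 by simp, ← ENNReal.ofReal_mul (by positivity)]
  congr 1
  ring

end StructuredPrediction

theorem mainTheorem3 :
    -- the constant of the `O`-term is absolute
    ∃ C : ℝ, 0 < C ∧
    ∀ -- the factor graph, with `l` variable nodes, and the input and output spaces
      (l : ℕ) (F : Type*) [Fintype F] (G : FactorGraph l F)
      (X : Type*) [MeasurableSpace X]
      (Y : Fin l → Type*) [∀ k, Finite (Y k)] [∀ k, MeasurableSpace (Y k)]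
      [∀ k, MeasurableSingletonClass (Y k)]
      (d : ℕ) (_ : ∀ f, Nat.card (G.FactorLabel Y f) = d)
      -- the loss on labels
      (L : (∀ k, Y k) → (∀ k, Y k) → ℝ) (_ : ∀ y y', 0 ≤ L y y')
      -- the features and the parameters of the hypothesis class
      (dim : ℕ) (p q Λ ρ : ℝ) (_ : 1 < p) (_ : p ≤ 2) (_ : q = p / (p - 1)) (_ : 0 ≤ Λ) (_ : 0 < ρ)
      (Ψ : ∀ f : F, X → G.FactorLabel Y f → Fin dim → ℝ)
      (_ : ∀ f y, Measurable fun x => Ψ f x y)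
      (_ : BddAbove (featureNorms G Ψ q))
      -- the stationary `β`-mixing process from which the documents are drawn
      (Ω₀ : Type*) [MeasurableSpace Ω₀] (P : Measure Ω₀) [IsProbabilityMeasure P]
      (ζ : ℤ → Ω₀ → X × (∀ k, Y k)) (_ : IsBetaMixing P ζ)
      -- the sample: `m` i.i.d. documents, each of which is distributed as `(ζ^1, …, ζ^J)`
      (m J a : ℕ) (_ : 0 < m) (_ : 0 < J) (_ : 0 < a) (_ : 2 * a ∣ J)
      (Ω : Type*) [MeasurableSpace Ω] (μ : Measure Ω) [IsProbabilityMeasure μ]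
      (D : Fin m → Ω → Fin J → X × (∀ k, Y k)) (_ : ∀ i, Measurable (D i))
      (_ : iIndepFun D μ)
      (_ : ∀ i, IdentDistrib (D i) (fun ω (j : Fin J) => ζ ((j : ℤ) + 1) ω) μ P)
      (δ : ℝ) (_ : 2 * m * ((J : ℝ) / (2 * a) - 1) * (betaCoeff P ζ a).toReal < δ),
      1 - δ ≤ μ.real {ω | ∀ h ∈ linearClass G Ψ p Λ,
        trueRisk μ L ρ D h ≤ empiricalRisk L ρ (fun i => D i ω) h
          + C * (Real.sqrt (2 * a * (q - 1)) * featureBound G Ψ q * Λ * Fintype.card F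
              / (ρ * Real.sqrt (m * J))
              * logFactor (m * J) d (Fintype.card F) (featureBound G Ψ q) Λ ρ)
          + maxLoss L * Real.sqrt a
              * Real.sqrt (Real.log
                  (2 / (δ - 2 * m * ((J : ℝ) / (2 * a) - 1) * (betaCoeff P ζ a).toReal)))
              / Real.sqrt (m * J)} := by
  refine ⟨306, by norm_num, ?_⟩
  intro l F _ G X _ Y _ _ _ d hd L hL dim p q Λ ρ hp1 hp2 hq hΛ hρ Ψ hΨ hbdd Ω₀ _ P _ ζ hζ m J a
    hm hJ0 ha hdvd Ω _ μ _ D hD hind hlaw δ hδ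
  classical
  obtain ⟨b, hJ⟩ := hdvd
  -- With n + 1 blocks of each parity per document, n is the number J/(2a) - 1 in front of β(a).
  obtain ⟨n, rfl⟩ : ∃ n, b = n + 1 :=
    Nat.exists_eq_succ_of_ne_zero (by rintro rfl; simp [hJ] at hJ0)
  have hpq : p.HolderConjugate q := by
    rw [hq]; exact Real.HolderConjugate.conjExponent hp1
  have hq2 : 2 ≤ q := by
    rw [hq, le_div_iff₀ (by linarith)]; linarith
  have ha' : (0 : ℝ) < a := by exact_mod_cast ha
  have hm' : (0 : ℝ) < m := by exact_mod_cast hm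
  have hJr : (J : ℝ) = 2 * a * (n + 1) := by rw [hJ]; push_cast; ring
  have hmJ : (m : ℝ) * J = 2 * a * (m * (n + 1) : ℕ) := by rw [hJr]; push_cast; ring
  have hJn : (J : ℝ) / (2 * a) - 1 = n := by rw [hJr]; field_simp; ring
  rw [hJn] at hδ ⊢
  have hβ1 := betaCoeff_le_one (P := P) hζ.measurable a
  have hβ : betaCoeff P ζ a = ENNReal.ofReal (betaCoeff P ζ a).toReal :=
    (ENNReal.ofReal_toReal (ne_top_of_le_ne_top ENNReal.one_ne_top hβ1)).symm
  set β := (betaCoeff P ζ a).toReal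
  have hβ0 : 0 ≤ β := ENNReal.toReal_nonneg
  have hmnβ : 0 ≤ 2 * (m : ℝ) * n * β := by positivity
  set B := featureBound G Ψ q with hB
  have hB0 : 0 ≤ B := featureBound_nonneg q
  set M := maxLoss L with hM
  have hM0 : 0 ≤ M := maxLoss_nonneg hL
  -- For δ ≥ 1 there is nothing to prove. Otherwise η < 2, so log(2/η) is nonnegative.
  rcases le_or_gt 1 δ with hδ1 | hδ1
  · exact (by linarith : 1 - δ ≤ 0).trans measureReal_nonneg
  set η := δ - 2 * m * n * β with hη
  have hη0 : 0 < η := by linarith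
  have hJ1 : (1 : ℝ) ≤ m * J := by exact_mod_cast Nat.mul_pos hm hJ0
  set main := 306 * (√(2 * a * (q - 1)) * B * Λ * Fintype.card F / (ρ * √(m * J))
    * logFactor (m * J) d (Fintype.card F) B Λ ρ) with hmain
  have hmain0 : 0 ≤ main := by
    have : 0 ≤ Real.log (m * J) := Real.log_nonneg hJ1
    unfold logFactor at hmain
    rw [hmain]; positivity
  set t := M * √a * √(Real.log (2 / η)) / √(m * J) with ht
  have ht0 : 0 ≤ t := by positivity
  set g : (Fin dim → ℝ) → X × (∀ k, Y k) → ℝ := fun w => marginLoss L ρ (linearScore Ψ w) with hg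
  have hgm : ∀ w, Measurable (g w) := fun w => measurable_marginLoss (measurable_linearScore hΨ w)
  have hgM : ∀ w z, g w z ∈ Set.Icc 0 M := fun w z => marginLoss_mem_Icc hL _ z
  have hgabs : ∀ w z, |g w z| ≤ M := fun w z =>
    abs_le.2 ⟨by linarith [(hgM w z).1], (hgM w z).2⟩
  have hgLip : ∀ u v z, |g u z - g v z|
      ≤ 2 * Fintype.card F / ρ * B * pNorm p (fun i => u i - v i) := by
    intro u v z
    have := abs_marginLoss_linearScore_sub_le (Ψ := Ψ) (L := L) hρ (u := u) (v := v) (z := z)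
      (η := pNorm p (fun i => u i - v i) * B) fun f y =>
        (abs_sum_mul_le_pNorm_mul_pNorm hpq (fun i => u i - v i) (Ψ f z.1 y)).trans
          (mul_le_mul_of_nonneg_left (pNorm_le_featureBound hbdd f z.1 y) (pNorm_nonneg _ _))
    refine this.trans_eq ?_
    ring
  set E : (Fin dim → ℝ) → Ω → ℝ := fun w ω =>
    ∫ ω, g w (ζ 0 ω) ∂P - 1 / ((m : ℝ) * (J : ℝ)) * ∑ i, ∑ j, g w (D i ω j) with hE
  have hEcont : ∀ ω, Continuous fun w => E w ω := by
    intro ω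
    refine Continuous.sub ?_ (continuous_const.mul (continuous_finsetSum _ fun i _ =>
      continuous_finsetSum _ fun j _ => ?_))
    · refine continuous_of_abs_sub_le_pNorm hpq.pos
        (c := 2 * Fintype.card F / ρ * B) fun u v => ?_
      have hi : ∀ w, Integrable (fun ω => g w (ζ 0 ω)) P := fun w =>
        integrable_of_measurable_of_abs_le ((hgm w).comp (hζ.measurable 0)) fun ω => hgabs w _
      rw [← integral_sub (hi u) (hi v)]
      exact abs_integral_le_of_abs_le fun ω => hgLip u v _
    · exact continuous_of_abs_sub_le_pNorm hpq.pos
        (c := 2 * Fintype.card F / ρ * B) fun u v => hgLip u v _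
  have hfin : ∀ W : Finset (Fin dim → ℝ), (∀ w ∈ W, pNorm p w ≤ Λ) →
      μ {ω | ∃ w ∈ W, main + t < E w ω} ≤ ENNReal.ofReal δ := by
    intro W hW
    -- The concentration bound divides by M. For M = 0 all losses vanish and no deviation occurs.
    rcases hM0.eq_or_lt with hM00 | hMpos
    · have hg0 : ∀ w z, g w z = 0 := fun w z =>
        le_antisymm ((hgM w z).2.trans_eq hM00.symm) (hgM w z).1
      have : {ω | ∃ w ∈ W, main + t < E w ω} = ∅ := by
        ext ω
        simp only [hE, hg0, Set.mem_ofPred_eq, Set.mem_empty_iff_false, iff_false]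
        rintro ⟨w, -, h⟩
        simp at h
        linarith
      rw [this]; simp
    -- Massart's lemma needs A > 0, whereas the logarithm is 0 when there are no factors.
    · set A := max 1 (Real.log (2 * (m * J) * d * Fintype.card F
        * (8 * B * Λ * (m * J) / ρ + 3) + 1)) with hA
      set R := Nat.clog 2 (2 * a * (m * (n + 1))) * (25 * (2 * Fintype.card F / ρ * (Λ * B))
        * √(m * (n + 1) : ℕ) * √((q - 1) * A)) + (m * (n + 1) : ℕ)
          * (2 * Fintype.card F / ρ * (Λ * B)) / 2 ^ Nat.clog 2 (2 * a * (m * (n + 1))) with hR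
      -- The number of vectors to cover is mJd|F|/2, one parity holding half of the tokens, so the
      -- logarithm in L̃ leaves room to spare.
      have hAlog : Real.log (2 * ((m * (n + 1) : ℕ) * a * d * Fintype.card F) + 1) ≤ A := by
        refine le_max_of_le_right (Real.log_le_log (by positivity) ?_)
        have h1 : 2 * ((m * (n + 1) : ℕ) * a * d * Fintype.card F : ℝ)
            = m * J * d * Fintype.card F := by rw [hmJ]; ring
        rw [h1]
        have h2 : 0 ≤ 8 * B * Λ * (m * J) / ρ := by positivity
        have h3 : (0 : ℝ) ≤ m * J * d * Fintype.card F := by positivity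
        nlinarith [mul_nonneg h3 h2]
      have hRmain : 2 * R / (m * (n + 1) : ℕ) ≤ main := by
        refine complexity_term_le ha (Nat.mul_pos hm (Nat.succ_pos n)) hmJ (by linarith) hB0 hΛ hρ
          (Nat.cast_nonneg _) fun hF => ?_
        have hF' : 0 < Fintype.card F := Nat.pos_of_ne_zero fun h => hF (by simp [h])
        refine ⟨?_, by exact_mod_cast hF'⟩
        -- d ≥ 1 because a value of the process provides a label, and its projection is a label of
        -- f.
        obtain ⟨f⟩ := Fintype.card_pos_iff.1 hF'
        obtain ⟨ω₀⟩ := nonempty_of_isProbabilityMeasure P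
        have : Nonempty (G.FactorLabel Y f) := ⟨G.proj f (ζ 0 ω₀).2⟩
        have : 0 < d := by rw [← hd f]; exact Nat.card_pos
        exact_mod_cast this
      have h := measure_exists_sample_deviation_le (μ := μ) hζ.measurable hζ.stationary ha hm hJ hD
        hind hlaw hMpos (W := W) (g := g) (fun w _ => hgm w) (fun w _ => hgM w) (R := R)
        (fun hWne S => signAvg_sup'_marginLoss_le hd L hpq hq2 hΛ hρ hbdd ha
          (lt_max_of_lt_left one_pos) hAlog _ hW hWne S) ht0
      rw [ht, exp_deviation_eq hMpos ha (Nat.mul_pos hm (Nat.succ_pos n)) hmJ hη0 (by linarith), hβ,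
        ofReal_confidence_eq hη0.le hβ0, ← ht, hη, sub_add_cancel] at h
      refine (measure_mono ?_).trans h
      rintro ω ⟨w, hw, hlt⟩
      exact ⟨w, hw, (by linarith : _ ≤ main + t).trans_lt hlt⟩
  have : Nonempty {w : Fin dim → ℝ // pNorm p w ≤ Λ} := ⟨⟨0, by rwa [pNorm_zero hpq.pos]⟩⟩
  have hgood := one_sub_le_measureReal_forall_le (μ := μ)
    (V := {w : Fin dim → ℝ // pNorm p w ≤ Λ}) (E := fun w => E w.1) (c := main + t) (δ := δ)
    (fun ω => (hEcont ω).comp continuous_subtype_val) (by linarith) fun W => by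
      have := hfin (W.image Subtype.val) fun w hw => by
        obtain ⟨v, -, rfl⟩ := Finset.mem_image.1 hw
        exact v.2
      simpa only [Finset.exists_mem_image] using this
  refine hgood.trans (measureReal_mono ?_)
  rintro ω hω h ⟨w, hw, hh⟩
  obtain rfl : h = linearScore Ψ w := funext fun x => funext fun y => hh x y
  have h1 := hω ⟨w, hw⟩
  have h2 : trueRisk μ L ρ D (linearScore Ψ w) = ∫ ω, g w (ζ 0 ω) ∂P :=
    integral_sample_average hζ.stationary hm hJ0 hD hlaw (hgm w) (hgabs w)
  simp only [hE] at h1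
  rw [h2]
  unfold empiricalRisk
  linarith
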